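/- **Security against active malicious clients, with honest server.** *Protocol.* Let $\mathcal U=\{u_1,\dots,u_n\}$ be the clients, $0<t<n$, let $P>q$ be primes with $P>n$, $\mathbb G=\langle g\rangle$ a cyclic group of order $q$, $H:\mathbb N\to\mathbb G$ a public (hash) function, $\mathrm{HPRG}(s)=(H(1)^s,\dots,H(m)^s)$, and fix a signature scheme and a public-key encryption scheme in which genuine signatures always verify and genuine ciphertexts always decrypt correctly; all this may depend on a security parameter $\kappa$. All key pairs of clients and server are generated honestly, and the public keys are known to everybody. Client $u_i$ has an input $x_i\in\mathbb Z_q^m$. In one run: (1) $u_i$ draws a seed $s_i\in\mathbb Z_q$ uniformly, computes $t$-out-of-$n$ Shamir shares $s_i^1,\dots,s_i^n$ of $s_i$ over $\mathbb Z_P$ (at the points $1,\dots,n$), and sends to each $u_j$ the encryption of $s_i^j$ under $u_j$'s key with a signature on the ciphertext; a client that receives an invalid signature aborts; $\mathcal U_1$ is the set of clients from which at least $t$ other clients received a share. (2) $u_i$ sends $y_i=g^{x_i}\cdot \mathrm{HPRG}(s_i)$ (entrywise) with a signature to the server; $\mathcal U_2\subseteq\mathcal U_1$ is the set of clients whose $y_i$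 arrived with a valid signature. (3) The server publishes to the clients the list $\mathcal U_2$ with its signature; the clients in $\mathcal U_2$ verify it and return a signature on $\mathcal U_2$; $\mathcal U_3\subseteq\mathcal U_2$ is the set of clients whose signatures arrived; if $|\mathcal U_3|\ge t$ the server forwards these signatures to the clients in $\mathcal U_3$, otherwise it aborts. (4) Each $u_i\in\mathcal U_3$ aborts if one of the forwarded signatures is invalid (or if it lacks a share of some $u_j\in\mathcal U_3$), and otherwise sends $\sum_{u_j\in\mathcal U_3}s_j^i \bmod P$ to the server, encrypted and signed; with the validly signed shares of a set $\mathcal U_4\subseteq\mathcal U_3$, $|\mathcal U_4|>t$, the server reconstructs $s_R$ and outputs $\log_g\bigl(\prod_{u_i\in\mathcal U_3}y_i/\mathrm{HPRG}(s_R)\bigr)$. *Adversary.* The server is honest. The clients in $\mathcal C\subseteq\mathcal U$ are controlled by an arbitrary probabilistic next-message algorithm $M_{\mathcal C}$, which knows their secret keys and all public keys, chooses their messages in every step as a function of its coins and of everything they have received so far, and in the same way decides in every step which honest clients are connected (in step 1: which individual messages of honest clients arrive). $\mathsf{REAL}_{\mathcal C}^{\mathcal U,t,\kappa}(M_{\mathcal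 C})$, for honest inputs $x_{\mathcal U\setminus\mathcal C}$, is the joint view of the clients in $\mathcal C$: the coins of $M_{\mathcal C}$, the keys they know, and all messages they receive. *Ideal functionality $\mathcal F_{HSecAgg}$.* A trusted party $\mathcal T$ receives seeds from a set $\mathcal U_1$ of clients and sends to each client in $\mathcal U_1$ the list $\mathcal U_1$ and its Shamir shares of these seeds; it receives masked models $y_i$ from a set $\mathcal U_2\subseteq\mathcal U_1$; it sends the list $\mathcal U_3\subseteq\mathcal U_2$ of still connected clients to the clients in $\mathcal U_2$; it receives shares of the sum of the seeds of $\mathcal U_3$ from a set $\mathcal U_4\subseteq\mathcal U_3$; it computes the sum of the inputs of $\mathcal U_3$ from the $y_i$ and these shares as above, and sends it to the server. It aborts as soon as one of the sets has fewer than $t$ elements. In the ideal execution, honest clients give uniformly random seeds, $y_i=g^{x_i}\mathrm{HPRG}(s_i)$, and their sums of shares to $\mathcal T$ only; a simulator $\mathsf{SIM}$ plays the clients in $\mathcal C$, decides which honest clients are connected in each step, receives only what $\mathcal T$ sends to clients in $\mathcal C$, and may call $M_{\mathcal C}$ and the building blocks as oracles; $\mathsf{SIM}_{\mathcal C}^{\mathcal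 U,t,\kappa}(M_{\mathcal C},x_{\mathcal U\setminus\mathcal C})$ is the view it outputs at the end when the honest inputs are $x_{\mathcal U\setminus\mathcal C}$. *Theorem.* There is a single probabilistic polynomial-time simulator $\mathsf{SIM}$ such that for all $\mathcal U,t,\kappa$ (and all public parameters and building blocks as above), all $\mathcal C\subseteq\mathcal U$ with $|\mathcal C|<t$, all $M_{\mathcal C}$ and all $x_{\mathcal U\setminus\mathcal C}$, $$\mathsf{SIM}_\mathcal{C}^{\mathcal{U}, t, \kappa}(M_{\mathcal C}, x_{\mathcal{U\setminus C}}) \equiv \mathsf{REAL}_\mathcal{C}^{\mathcal{U}, t, \kappa}(M_{\mathcal C}),$$ where $\equiv$ means that the distributions are identical. Polynomial time means: $\mathsf{SIM}$ is a fixed program, and its number of steps is, in every execution, bounded by a fixed polynomial in $\kappa$, $n$, $m$, the time charged for one arithmetic operation or one call of a building block, and the time charged for one call of $M_{\mathcal C}$. -/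

import Mathlib

open scoped BigOperators

noncomputable section

namespace HSecAgg

/-! ## Independent sampling -/

/-- Independent samples from finitely many distributions. -/
def sampleAll {α : Type} : {n : ℕ} → (Fin n → PMF α) → PMF (Fin n → α)
  | 0, _ => PMF.pure Fin.elim0
  | _ + 1, f => (f 0).bind fun a =>
      (sampleAll fun i => f i.succ).bind fun r => PMF.pure (Fin.cons a r)

/-- A set of clients, given by its indicator function. -/
abbrev ClientSet (n : ℕ) := Fin n → Bool

/-- The set of clients as a finset. -/
def members {n : ℕ} (A : ClientSet n) : Finset (Fin n) := Finset.univ.filter fun i => A i = true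

/-- The number of members of a set of clients. -/
def size {n : ℕ} (A : ClientSet n) : ℕ := (members A).card

/-! ## Building blocks -/

/-- A signature scheme: key generation (secret key, public key), randomized signing and
deterministic verification; genuine signatures are always accepted. -/
structure SignatureScheme (Msg : Type) where
  SK : Type
  PK : Type
  Sig : Type
  keygen : PMF (SK × PK)
  sign : SK → Msg → PMF Sig
  verify : PK → Msg → Sig → Bool
  correct : ∀ k ∈ keygen.support, ∀ msg, ∀ σ ∈ (sign k.1 msg).support, verify k.2 msg σ = true

/-- A public-key encryption scheme: key generation (secret key, public key), randomized
encryption and deterministic decryption; genuine ciphertexts decrypt to their plaintext. -/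
structure EncryptionScheme (Plain : Type) where
  SK : Type
  PK : Type
  CT : Type
  keygen : PMF (SK × PK)
  enc : PK → Plain → PMF CT
  dec : SK → CT → Plain
  correct : ∀ k ∈ keygen.support, ∀ a, ∀ c ∈ (enc k.2 a).support, dec k.1 c = a

/-- The kinds of data that are signed in the protocol: ciphertexts, masked vectors, and
lists of clients. -/
inductive SignedData (n m : ℕ) (CT G : Type) : Type
  | cipher (c : CT)
  | masked (y : Fin m → G)
  | clients (A : ClientSet n)

/-- The public parameters of the protocol and its building blocks for one value `κ` of the security
parameter: `n` clients (with identifiers `1, …, n`), vectors of length `m`, threshold `t`, the field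
`ℤ_P` for secret sharing, the cyclic group `G = ⟨g⟩` of prime order `q`, the hash
function `H` (an arbitrary function, so every outcome of a random oracle is covered).
`callTime` is the time charged for one operation in `ℤ_P`, `ℤ_q`, `G`, or for one call of an
algorithm of the two schemes. -/
structure Setting where
  κ : ℕ
  n : ℕ
  m : ℕ
  t : ℕ
  P : ℕ
  q : ℕ
  callTime : ℕ
  P_prime : Fact P.Prime
  q_prime : Fact q.Prime
  t_pos : 0 < t
  t_lt : t < n
  n_lt : n < P
  q_lt : q < P
  G : Type
  grp : CommGroup G
  g : G
  card_G : Nat.card G = q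
  gen_G : ∀ y : G, y ∈ Subgroup.zpowers g
  H : ℕ → G
  encr : EncryptionScheme (ZMod P)
  sign : SignatureScheme (SignedData n m encr.CT G)

attribute [instance] Setting.P_prime Setting.q_prime Setting.grp

namespace Setting

variable (S : Setting)

abbrev CT := S.encr.CT
abbrev CSK := S.encr.SK
abbrev CPK := S.encr.PK
abbrev Sig := S.sign.Sig
abbrev SSK := S.sign.SK
abbrev SPK := S.sign.PK
/-- Masked vectors. -/
abbrev Vec := Fin S.m → S.G

/-- A uniformly random seed. -/
def randSeed : PMF (ZMod S.q) := PMF.uniformOfFintype (ZMod S.q)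

/-- The evaluation point of a client: its identifier in `{1, …, n}`. -/
def point (j : Fin S.n) : ZMod S.P := (((j : ℕ) + 1 : ℕ) : ZMod S.P)

/-- Share generation for `t`-out-of-`n` Shamir sharing of a seed: a random polynomial
of degree at most `t - 1` with the seed as constant term, evaluated at the points of the clients. -/
def share (s : ZMod S.q) : PMF (Fin S.n → ZMod S.P) :=
  (sampleAll fun _ : Fin (S.t - 1) => PMF.uniformOfFintype (ZMod S.P)).bind fun a =>
    PMF.pure fun j => ((s.val : ℕ) : ZMod S.P) + ∑ k, a k * S.point j ^ ((k : ℕ) + 1)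

/-- Secret reconstruction from the shares of the clients in `A` (Lagrange interpolation at `0`). -/
def reconstruct (A : ClientSet S.n) (sh : Fin S.n → ZMod S.P) : ZMod S.P :=
  (Lagrange.interpolate (members A) S.point sh).eval 0

/-- The homomorphic pseudorandom generator `s ↦ (H(1)^s, …, H(m)^s)`. -/
def hprg (s : ℕ) : S.Vec := fun k => S.H ((k : ℕ) + 1) ^ s

/-- The masked model `g^x · HPRG(s)`. -/
def mask (x : Fin S.m → ZMod S.q) (s : ZMod S.q) : S.Vec :=
  fun k => S.g ^ (x k).val * S.hprg s.val k

/-- The discrete logarithm to base `g`. -/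
def dlog (y : S.G) : ZMod S.q := Function.invFun (fun z : ZMod S.q => S.g ^ z.val) y

/-- Unmasking: from the masked models of the clients in `A` and the shares of the sum of
the seeds held by the clients in `B`, compute the logarithm of the product of the masked models
divided by the reconstructed mask. -/
def unmask (A B : ClientSet S.n) (y : Fin S.n → S.Vec) (sh : Fin S.n → ZMod S.P) :
    Fin S.m → ZMod S.q :=
  fun k => S.dlog ((∏ i ∈ members A, y i k) / S.hprg (S.reconstruct B sh).val k)

/-! ## What the corrupted clients receive -/

/-- Before the protocol: the public signature and encryption keys of the clients, those of
the server, and the secret keys of the corrupted clients. -/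
abbrev SetupMsg :=
  (Fin S.n → S.SPK) × (Fin S.n → S.CPK) × S.SPK × S.CPK × (Fin S.n → Option (S.SSK × S.CSK))

/-- Step 1: the entry `i j` is the signed ciphertext sent by the honest client `i` and received
by the corrupted client `j`, if any. -/
abbrev Msg1 := Fin S.n → Fin S.n → Option (S.CT × S.Sig)

/-- Step 3, first part: the list `U₂` and the signature of the server on it. -/
abbrev Msg3 := ClientSet S.n × S.Sig

/-- Step 3, second part: the signatures of the clients in `U₃` on `U₂`, if they are forwarded to
a corrupted client. -/
abbrev Msg4 := Option (Fin S.n → Option S.Sig)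

/-- The joint view of the corrupted clients: their random coins and all they received; `View0`,
`View1`, `View3` are its initial segments. -/
abbrev View0 (Ω : Type) := Ω × S.SetupMsg
abbrev View1 (Ω : Type) := S.View0 Ω × S.Msg1
abbrev View3 (Ω : Type) := S.View1 Ω × S.Msg3
abbrev View (Ω : Type) := S.View3 Ω × S.Msg4

end Setting

/-- The next-message algorithm of the corrupted clients: random coins from an arbitrary
distribution, and in each step arbitrary functions of the coins and of all that was received so far.
It also schedules which honest clients are connected in each step. Only the entries of corrupted
clients count in the messages, and only those of honest clients count in the connection
schedule. `time` is the time charged for one call. -/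
structure Adversary (S : Setting) where
  Coins : Type
  coins : PMF Coins
  time : ℕ
  /-- Step 1: which messages from honest to corrupted clients arrive. -/
  deliver1 : S.View0 Coins → Fin S.n → Fin S.n → Bool
  /-- Step 1: which messages between honest clients arrive, and the messages from corrupted
  clients to all clients. -/
  send1 : S.View1 Coins →
    (Fin S.n → Fin S.n → Bool) × (Fin S.n → Fin S.n → Option (S.CT × S.Sig))
  /-- Step 2: which honest clients are connected, and the signed masked models of corrupted
  clients. -/
  send2 : S.View1 Coins → ClientSet S.n × (Fin S.n → Option (S.Vec × S.Sig))
  /-- Step 3: which honest clients are connected, and the signatures of corrupted clients. -/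
  send3 : S.View3 Coins → ClientSet S.n × (Fin S.n → Option S.Sig)
  /-- Step 4: which honest clients are connected, and the signed encrypted shares of
  corrupted clients. -/
  send4 : S.View Coins → ClientSet S.n × (Fin S.n → Option (S.CT × S.Sig))

/-! ## The real execution -/

section Real

variable (S : Setting) (C : Finset (Fin S.n)) (M : Adversary S)

/-- The execution of the protocol with an honest server, honest clients outside `C` with inputs `x`,
and the clients in `C` played by `M`. The outcome is the joint view of the clients in `C`
together with the output of the server (`none` if it aborts). -/
def real (x : {i : Fin S.n // i ∉ C} → Fin S.m → ZMod S.q) :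
    PMF (S.View M.Coins × Option (Fin S.m → ZMod S.q)) := do
  let ρ ← M.coins
  -- keys
  let sk ← sampleAll fun _ : Fin S.n => S.sign.keygen
  let ck ← sampleAll fun _ : Fin S.n => S.encr.keygen
  let sks ← S.sign.keygen
  let cks ← S.encr.keygen
  let setup : S.SetupMsg :=
    (fun i => (sk i).2, fun i => (ck i).2, sks.2, cks.2,
      fun i => if i ∈ C then some ((sk i).1, (ck i).1) else none)
  let v0 : S.View0 M.Coins := (ρ, setup)
  -- Step 1: seeds, shares, encryptions, signatures
  -- (the values drawn here for corrupted clients are never used)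
  let seed ← sampleAll fun _ : Fin S.n => S.randSeed
  let sh ← sampleAll fun i => S.share (seed i)
  let ct ← sampleAll fun i => sampleAll fun j => S.encr.enc (ck j).2 (sh i j)
  let σ1 ← sampleAll fun i => sampleAll fun j => S.sign.sign (sk i).1 (.cipher (ct i j))
  let msg1 : S.Msg1 := fun i j =>
    if i ∉ C ∧ j ∈ C ∧ M.deliver1 v0 i j then some (ct i j, σ1 i j) else none
  let v1 : S.View1 M.Coins := (v0, msg1)
  -- the message from `i` received by `j`
  let recv : Fin S.n → Fin S.n → Option (S.CT × S.Sig) := fun i j =>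
    if i ∈ C then (M.send1 v1).2 i j
    else if j ∈ C then msg1 i j
    else if i = j ∨ (M.send1 v1).1 i j then some (ct i j, σ1 i j) else none
  -- the clients of whose seeds at least `t` shares were received by other clients
  let U1 : ClientSet S.n := fun i => decide (S.t ≤ size fun j => decide (j ≠ i) && (recv i j).isSome)
  -- clients that received no invalid signature; the others abort
  let alive : ClientSet S.n := fun j =>
    decide (∀ i, (recv i j).all (fun p => S.sign.verify (sk i).2 (.cipher p.1) p.2) = true)
  -- Step 2: masked models
  let up2 : Fin S.n → Option (S.Vec × S.Sig) ← sampleAll fun i =>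
    if h : i ∈ C then PMF.pure ((M.send2 v1).2 i)
    else if alive i && (M.send2 v1).1 i then do
      let y := S.mask (x ⟨i, h⟩) (seed i)
      let σ ← S.sign.sign (sk i).1 (.masked y)
      PMF.pure (some (y, σ))
    else PMF.pure none
  let U2 : ClientSet S.n := fun i =>
    U1 i && (up2 i).any fun p => S.sign.verify (sk i).2 (.masked p.1) p.2
  -- Step 3: consistency check
  let σ3 ← S.sign.sign sks.1 (.clients U2)
  let v3 : S.View3 M.Coins := (v1, (U2, σ3))
  let up3 : Fin S.n → Option S.Sig ← sampleAll fun i =>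
    if i ∈ C then PMF.pure ((M.send3 v3).2 i)
    else if U2 i && (M.send3 v3).1 i && S.sign.verify sks.2 (.clients U2) σ3 then do
      let σ ← S.sign.sign (sk i).1 (.clients U2)
      PMF.pure (some σ)
    else PMF.pure none
  let U3 : ClientSet S.n := fun i => U2 i && (up3 i).isSome
  -- the server goes on only if at least `t` signatures arrived
  let go : Bool := decide (S.t ≤ size U3)
  let msg4 : S.Msg4 :=
    if go = true ∧ ∃ j ∈ C, U3 j then some fun i => if U3 i then up3 i else none else none
  let v : S.View M.Coins := (v3, msg4)
  -- Step 4: unmasking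
  let consistent : Bool :=
    decide (∀ j, U3 j → (up3 j).any (fun σ => S.sign.verify (sk j).2 (.clients U2) σ) = true)
  let up4 : Fin S.n → Option (S.CT × S.Sig) ← sampleAll fun i =>
    if i ∈ C then PMF.pure ((M.send4 v).2 i)
    else if go && U3 i && (M.send4 v).1 i && consistent &&
        decide (∀ j, U3 j → (recv j i).isSome = true) then do
      let sR : ZMod S.P := ∑ j ∈ members U3,
        (recv j i).elim 0 fun p => S.encr.dec (ck i).1 p.1
      let c ← S.encr.enc cks.2 sR
      let σ ← S.sign.sign (sk i).1 (.cipher c)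
      PMF.pure (some (c, σ))
    else PMF.pure none
  let U4 : ClientSet S.n := fun i =>
    go && U3 i && (up4 i).any fun p => S.sign.verify (sk i).2 (.cipher p.1) p.2
  let out : Option (Fin S.m → ZMod S.q) :=
    if S.t < size U4 then
      some (S.unmask U3 U4 (fun i => (up2 i).elim 1 Prod.fst)
        fun i => (up4 i).elim 0 fun p => S.encr.dec cks.1 p.1)
    else none
  PMF.pure (v, out)

/-- The distribution of the joint view of the clients in `C` in the real execution. -/
def REAL (x : {i : Fin S.n // i ∉ C} → Fin S.m → ZMod S.q) : PMF (S.View M.Coins) :=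
  (real S C M x).map Prod.fst

end Real

/-! ## The ideal functionality

The steps of the trusted party; `none` means that it aborts. -/

namespace Functionality

variable (S : Setting)

/-- The trusted party receives seeds from a set `U₁` of clients and computes the Shamir shares of the
received seeds. Client `j ∈ U₁` is to be sent `U₁` and, for all `i ∈ U₁`, the entry `i j`. -/
def distribute (seed : Fin S.n → Option (ZMod S.q)) :
    PMF (Option (ClientSet S.n × (Fin S.n → Fin S.n → Option (ZMod S.P)))) :=
  (sampleAll fun i => match seed i with
    | none => PMF.pure none
    | some s => (S.share s).map some).bind fun sh =>
  PMF.pure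
    (if S.t ≤ size (fun i => (seed i).isSome) then
      some (fun i => (seed i).isSome, fun i j => (sh i).map fun r => r j)
    else none)

/-- The trusted party receives masked models from a set `U₂ ⊆ U₁`. -/
def collect (U1 : ClientSet S.n) (y : Fin S.n → Option S.Vec) : Option (ClientSet S.n) :=
  let U2 : ClientSet S.n := fun i => U1 i && (y i).isSome
  if S.t ≤ size U2 then some U2 else none

/-- The consistency check: the set `U₃ ⊆ U₂` of clients that are still connected. -/
def confirm (U2 connected : ClientSet S.n) : Option (ClientSet S.n) :=
  let U3 : ClientSet S.n := fun i => U2 i && connected i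
  if S.t ≤ size U3 then some U3 else none

/-- The trusted party receives shares for unmasking from a set `U₄ ⊆ U₃`, and computes the
sum of the inputs of the clients in `U₃` for the server. -/
def aggregate (U3 : ClientSet S.n) (y : Fin S.n → Option S.Vec) (sh : Fin S.n → Option (ZMod S.P)) :
    Option (Fin S.m → ZMod S.q) :=
  let U4 : ClientSet S.n := fun i => U3 i && (sh i).isSome
  if S.t ≤ size U4 then
    some (S.unmask U3 U4 (fun i => (y i).getD 1) fun i => (sh i).getD 0)
  else none

end Functionality

/-! ## Simulators: a programming language with a step count

Programs are finite pieces of syntax that do not depend on any parameter. Their only access to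
the building blocks and to the next-message algorithm is by calls, and they have no access to the
inputs of the honest clients. -/

/-- Data types of the language. `arr a` is the type of arrays indexed by the clients. -/
inductive Ty : Type
  | unit | bool | client | seed | field
  | ct | csk | cpk | sig | ssk | spk | vec | coins
  | prod (a b : Ty)
  | opt (a : Ty)
  | arr (a : Ty)

namespace Ty

/-- The values of a data type. -/
abbrev Val (S : Setting) (M : Adversary S) : Ty → Type
  | unit => Unit
  | bool => Bool
  | client => Fin S.n
  | seed => ZMod S.q
  | field => ZMod S.P
  | ct => S.CT
  | csk => S.CSK
  | cpk => S.CPK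
  | sig => S.Sig
  | ssk => S.SSK
  | spk => S.SPK
  | vec => S.Vec
  | coins => M.Coins
  | prod a b => Val S M a × Val S M b
  | opt a => Option (Val S M a)
  | arr a => Fin S.n → Val S M a

abbrev set : Ty := arr bool
abbrev setup : Ty := prod (arr spk) (prod (arr cpk) (prod spk (prod cpk (arr (opt (prod ssk csk))))))
abbrev msg1 : Ty := arr (arr (opt (prod ct sig)))
abbrev view0 : Ty := prod coins setup
abbrev view1 : Ty := prod view0 msg1
abbrev view3 : Ty := prod view1 (prod set sig)
abbrev view : Ty := prod view3 (opt (arr (opt sig)))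

end Ty

/-- Basic operations, with the types of argument and result. -/
inductive Op : Ty → Ty → Type
  /- logic, client sets -/
  | tru : Op .unit .bool
  | not : Op .bool .bool
  | and : Op (.prod .bool .bool) .bool
  | or : Op (.prod .bool .bool) .bool
  | eqClient : Op (.prod .client .client) .bool
  | corrupted : Op .client .bool
  | all : Op .set .bool
  | atLeastT : Op .set .bool
  /- arithmetic -/
  | zero : Op .unit .field
  | add : Op (.prod .field .field) .field
  | mulVec : Op (.prod .vec .vec) .vec
  | randSeed : Op .unit .seed
  | share : Op .seed (.arr .field)
  | hprg : Op .seed .vec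
  /- encryption -/
  | encKeygen : Op .unit (.prod .csk .cpk)
  | enc : Op (.prod .cpk .field) .ct
  | dec : Op (.prod .csk .ct) .field
  /- signatures -/
  | sigKeygen : Op .unit (.prod .ssk .spk)
  | signCipher : Op (.prod .ssk .ct) .sig
  | signMasked : Op (.prod .ssk .vec) .sig
  | signClients : Op (.prod .ssk .set) .sig
  | verifyCipher : Op (.prod .spk (.prod .ct .sig)) .bool
  | verifyMasked : Op (.prod .spk (.prod .vec .sig)) .bool
  | verifyClients : Op (.prod .spk (.prod .set .sig)) .bool
  /- the next-message algorithm -/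
  | coins : Op .unit .coins
  | deliver1 : Op .view0 (.arr .set)
  | send1 : Op .view1 (.prod (.arr .set) (.arr (.arr (.opt (.prod .ct .sig)))))
  | send2 : Op .view1 (.prod .set (.arr (.opt (.prod .vec .sig))))
  | send3 : Op .view3 (.prod .set (.arr (.opt .sig)))
  | send4 : Op .view (.prod .set (.arr (.opt (.prod .ct .sig))))

namespace Op

variable (S : Setting) (C : Finset (Fin S.n)) (M : Adversary S)

/-- The (random) result of an operation. -/
def eval : {a b : Ty} → Op a b → a.Val S M → PMF (b.Val S M)
  | _, _, tru, _ => PMF.pure true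
  | _, _, not, u => PMF.pure (!u)
  | _, _, and, u => PMF.pure (u.1 && u.2)
  | _, _, or, u => PMF.pure (u.1 || u.2)
  | _, _, eqClient, u => PMF.pure (decide (u.1 = u.2))
  | _, _, corrupted, u => PMF.pure (decide (u ∈ C))
  | _, _, all, u => PMF.pure (decide (∀ i, u i = true))
  | _, _, atLeastT, u => PMF.pure (decide (S.t ≤ size u))
  | _, _, zero, _ => PMF.pure (0 : ZMod S.P)
  | _, _, add, u => PMF.pure (u.1 + u.2 : ZMod S.P)
  | _, _, mulVec, u => PMF.pure (u.1 * u.2 : S.Vec)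
  | _, _, randSeed, _ => S.randSeed
  | _, _, share, u => S.share u
  | _, _, hprg, u => PMF.pure (S.hprg (ZMod.val u))
  | _, _, encKeygen, _ => S.encr.keygen
  | _, _, enc, u => S.encr.enc u.1 u.2
  | _, _, dec, u => PMF.pure (S.encr.dec u.1 u.2)
  | _, _, sigKeygen, _ => S.sign.keygen
  | _, _, signCipher, u => S.sign.sign u.1 (.cipher u.2)
  | _, _, signMasked, u => S.sign.sign u.1 (.masked u.2)
  | _, _, signClients, u => S.sign.sign u.1 (.clients u.2)
  | _, _, verifyCipher, u => PMF.pure (S.sign.verify u.1 (.cipher u.2.1) u.2.2)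
  | _, _, verifyMasked, u => PMF.pure (S.sign.verify u.1 (.masked u.2.1) u.2.2)
  | _, _, verifyClients, u => PMF.pure (S.sign.verify u.1 (.clients u.2.1) u.2.2)
  | _, _, coins, _ => M.coins
  | _, _, deliver1, u => PMF.pure (M.deliver1 u)
  | _, _, send1, u => PMF.pure (M.send1 u)
  | _, _, send2, u => PMF.pure (M.send2 u)
  | _, _, send3, u => PMF.pure (M.send3 u)
  | _, _, send4, u => PMF.pure (M.send4 u)

/-- The number of steps charged for an operation. -/
def cost : {a b : Ty} → Op a b → ℕ
  | _, _, tru | _, _, not | _, _, and | _, _, or | _, _, eqClient | _, _, corrupted => 1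
  | _, _, all | _, _, atLeastT => S.n
  | _, _, share => S.n * S.t * (S.callTime + 1)
  | _, _, mulVec | _, _, hprg => (S.m + 1) * (S.callTime + 1)
  | _, _, coins | _, _, deliver1 | _, _, send1 | _, _, send2 | _, _, send3 | _, _, send4 => M.time + 1
  | _, _, zero | _, _, add | _, _, randSeed | _, _, encKeygen | _, _, enc | _, _, dec
  | _, _, sigKeygen | _, _, signCipher | _, _, signMasked | _, _, signClients
  | _, _, verifyCipher | _, _, verifyMasked | _, _, verifyClients => S.callTime + 1

end Op

/-- `Var Γ a`: a variable of type `a` in the context `Γ` (a position in the list). -/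
inductive Var : List Ty → Ty → Type
  | here {Γ : List Ty} {a : Ty} : Var (a :: Γ) a
  | there {Γ : List Ty} {a b : Ty} : Var Γ a → Var (b :: Γ) a

/-- Programs with free variables in `Γ` and result of type `a`. -/
inductive Prog : List Ty → Ty → Type
  | var {Γ : List Ty} {a : Ty} : Var Γ a → Prog Γ a
  | op {Γ : List Ty} {a b : Ty} : Op a b → Prog Γ a → Prog Γ b
  | bind {Γ : List Ty} {a b : Ty} : Prog Γ a → Prog (a :: Γ) b → Prog Γ b
  | unit {Γ : List Ty} : Prog Γ .unit
  | pair {Γ : List Ty} {a b : Ty} : Prog Γ a → Prog Γ b → Prog Γ (.prod a b)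
  | fst {Γ : List Ty} {a b : Ty} : Prog Γ (.prod a b) → Prog Γ a
  | snd {Γ : List Ty} {a b : Ty} : Prog Γ (.prod a b) → Prog Γ b
  | ite {Γ : List Ty} {a : Ty} : Prog Γ .bool → Prog Γ a → Prog Γ a → Prog Γ a
  | none {Γ : List Ty} {a : Ty} : Prog Γ (.opt a)
  | some {Γ : List Ty} {a : Ty} : Prog Γ a → Prog Γ (.opt a)
  | case {Γ : List Ty} {a b : Ty} : Prog Γ (.opt a) → Prog Γ b → Prog (a :: Γ) b → Prog Γ b
  /-- the array whose `i`-th entry is the result of running the body with the loop variable `i` -/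
  | tab {Γ : List Ty} {a : Ty} : Prog (.client :: Γ) a → Prog Γ (.arr a)
  | get {Γ : List Ty} {a : Ty} : Prog Γ (.arr a) → Prog Γ .client → Prog Γ a

section Run

variable (S : Setting) (C : Finset (Fin S.n)) (M : Adversary S)

/-- Values for the variables of a context. -/
abbrev Env : List Ty → Type
  | [] => Unit
  | a :: Γ => a.Val S M × Env Γ

/-- The value of a variable. -/
def Var.lookup : {Γ : List Ty} → {a : Ty} → Var Γ a → Env S M Γ → a.Val S M
  | _, _, .here, e => e.1
  | _, _, .there v, e => v.lookup e.2

/-- The joint distribution of the result of a program and of the number of its steps: every node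
of the program costs one step each time it is run, plus the cost of the operations. -/
def Prog.run : {Γ : List Ty} → {a : Ty} → Prog Γ a → Env S M Γ → PMF (a.Val S M × ℕ)
  | _, _, .var v, e => PMF.pure (v.lookup S M e, 1)
  | _, _, .op o p, e =>
      (p.run e).bind fun u => (o.eval S C M u.1).bind fun w => PMF.pure (w, u.2 + o.cost S M + 1)
  | _, _, .bind p r, e =>
      (p.run e).bind fun u => (r.run (u.1, e)).bind fun w => PMF.pure (w.1, u.2 + w.2 + 1)
  | _, _, .unit, _ => PMF.pure ((), 1)
  | _, _, .pair p r, e =>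
      (p.run e).bind fun u => (r.run e).bind fun w => PMF.pure ((u.1, w.1), u.2 + w.2 + 1)
  | _, _, .fst p, e => (p.run e).bind fun u => PMF.pure (u.1.1, u.2 + 1)
  | _, _, .snd p, e => (p.run e).bind fun u => PMF.pure (u.1.2, u.2 + 1)
  | _, _, .ite c p r, e =>
      (c.run e).bind fun b => (if b.1 = true then p.run e else r.run e).bind fun w =>
        PMF.pure (w.1, b.2 + w.2 + 1)
  | _, _, .none, _ => PMF.pure (Option.none, 1)
  | _, _, .some p, e => (p.run e).bind fun u => PMF.pure (Option.some u.1, u.2 + 1)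
  | _, _, .case p r s, e =>
      (p.run e).bind fun u =>
        (match u.1 with
          | Option.none => r.run e
          | Option.some z => s.run (z, e)).bind fun w => PMF.pure (w.1, u.2 + w.2 + 1)
  | _, _, .tab p, e =>
      (sampleAll fun i : Fin S.n => p.run (i, e)).bind fun r =>
        PMF.pure (fun i => (r i).1, (∑ i, (r i).2) + S.n + 1)
  | _, _, .get p r, e =>
      (p.run e).bind fun u => (r.run e).bind fun w => PMF.pure (u.1 w.1, u.2 + w.2 + 1)

end Run

/-- A simulator plays the corrupted clients against the trusted party, in three activations
between which it keeps states of the types `state1` and `state2`; at the end it outputs a view.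
* First activation: the honest clients that are connected when the seeds are handed in, and the seeds
  of the corrupted clients. It then receives what the trusted party sends to the corrupted
  clients: the list `U₁` and their shares.
* Second activation: the honest clients that are connected when the masked models are handed in, the
  masked models of the corrupted clients, and the clients that stay connected for the
  consistency check. It then receives the list `U₃`, if it is sent to a corrupted client.
* Third activation: the honest clients that are connected for unmasking, the shares for
  unmasking of the corrupted clients, and the simulated view. -/
structure Simulator where
  state1 : Ty
  state2 : Ty
  first : Prog [] (.prod (.prod .set (.arr (.opt .seed))) state1)
  second : Prog [.opt (.prod .set (.arr (.arr (.opt .field)))), state1]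
    (.prod (.prod (.prod .set (.arr (.opt .vec))) .set) state2)
  third : Prog [.opt .set, state2] (.prod (.prod .set (.arr (.opt .field))) .view)

/-! ## The ideal execution -/

section Ideal

variable (S : Setting) (C : Finset (Fin S.n)) (M : Adversary S) (sim : Simulator)

/-- The result of an ideal execution. -/
structure IdealOutcome where
  /-- the view that the simulator outputs -/
  view : S.View M.Coins
  /-- the output that the server receives from the trusted party -/
  output : Option (Fin S.m → ZMod S.q)
  /-- the number of steps of the simulator -/
  steps : ℕ

/-- The execution with the trusted party. The honest clients have inputs `x` and uniformly random
seeds, which they give to the trusted party only. -/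
def ideal (x : {i : Fin S.n // i ∉ C} → Fin S.m → ZMod S.q) : PMF (IdealOutcome S M) := do
  let hseed ← sampleAll fun _ : Fin S.n => S.randSeed
  -- seeds and shares
  let a ← sim.first.run S C M ()
  let seed : Fin S.n → Option (ZMod S.q) := fun i =>
    if i ∈ C then a.1.1.2 i else if a.1.1.1 i then some (hseed i) else none
  let d ← Functionality.distribute S seed
  let leak1 : Option (ClientSet S.n × (Fin S.n → Fin S.n → Option (ZMod S.P))) :=
    d.bind fun r =>
      if ∃ j ∈ C, r.1 j then
        some (r.1, fun i j => if j ∈ C ∧ r.1 j then r.2 i j else none)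
      else none
  -- masked models and consistency check
  let b ← sim.second.run S C M (leak1, (a.1.2, ()))
  let y : Fin S.n → Option S.Vec := fun i =>
    if h : i ∈ C then b.1.1.1.2 i
    else if b.1.1.1.1 i then some (S.mask (x ⟨i, h⟩) (hseed i)) else none
  let U2 : Option (ClientSet S.n) := d.bind fun r => Functionality.collect S r.1 y
  let U3 : Option (ClientSet S.n) := U2.bind fun A => Functionality.confirm S A b.1.1.2
  let leak3 : Option (ClientSet S.n) :=
    U2.bind fun A => if ∃ j ∈ C, A j then U3 else none
  -- unmasking
  let c ← sim.third.run S C M (leak3, (b.1.2, ()))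
  let out : Option (Fin S.m → ZMod S.q) :=
    d.bind fun r => U3.bind fun A =>
      Functionality.aggregate S A y fun i =>
        if i ∈ C then c.1.1.2 i
        else if c.1.1.1 i then some (∑ j ∈ members A, (r.2 j i).getD 0) else none
  PMF.pure ⟨c.1.2, out, a.2 + b.2 + c.2⟩

/-- The distribution of the view that the simulator outputs in the ideal execution. -/
def SIM (x : {i : Fin S.n // i ∉ C} → Fin S.m → ZMod S.q) : PMF (S.View M.Coins) :=
  (ideal S C M sim x).map IdealOutcome.view

end Ideal

end HSecAgg

end

noncomputable section

namespace HSecAgg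

/-! ## Independent sampling -/

section Sampling

variable {α β γ : Type}

/-! With an honest server, nothing the corrupted clients receive depends on the values of the masked
models. They see keys, encrypted shares addressed to them, the list `U₂`, the server's signature on
it, and the forwarded signatures. The masked models go to the server alone and enter the view only
through the membership test for `U₂`. An honest model carries a genuine signature, so that test is
decided by deliveries and by messages of corrupted clients. Step 4 sends nothing back to the
clients.

Hence the view has the distribution `viewDist`, in which the honest inputs do not occur, and both
executions are shown to equal it. In the real execution (`REAL_eq_viewDist`) the values used only at
the server are integrated out, after `realAccepted_eq` has shown that `U₂` is constant on the
support of the masked models.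

In the ideal execution (`SIM_eq_viewDist`) the simulator draws honest keys, runs the adversary on
encryptions of the shares given by the trusted party, and hands in connection sets that make the
trusted party compute the `U₃` of the simulated run (`forwardedFrom_listOf`). The same shares leak
on both sides, so the equality is exact and no hiding property of encryption or secret sharing
enters.

Running time is a property of the language: programs are finite syntax whose only loops have length
`n`, so every simulator is polynomial (`Simulator.exists_steps_le`). -/

theorem sampleAll_pure {n : ℕ} (f : Fin n → α) : (sampleAll fun i => PMF.pure (f i)) = PMF.pure f := by
  induction n with
  | zero => exact congrArg PMF.pure (Subsingleton.elim _ _)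
  | succ n ih =>
    simp only [sampleAll, PMF.pure_bind, ih]
    exact congrArg PMF.pure (Fin.cons_self_tail f)

theorem sampleAll_bind {n : ℕ} (f : Fin n → PMF α) (g : Fin n → α → PMF β) :
    ((sampleAll f).bind fun a => sampleAll fun i => g i (a i)) =
      sampleAll fun i => (f i).bind (g i) := by
  induction n with
  | zero => simp [sampleAll]
  | succ n ih =>
    simp only [sampleAll, PMF.bind_bind, PMF.pure_bind, Fin.cons_zero, Fin.cons_succ, ← ih]
    refine congrArg _ (funext fun a => ?_)
    -- The second-round draw of the first coordinate is independent of the first-round draws of the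
    -- others, so the two may be exchanged.
    rw [PMF.bind_comm]

theorem sampleAll_map {n : ℕ} (f : Fin n → PMF α) (h : Fin n → α → β) :
    (sampleAll f).map (fun a i => h i (a i)) = sampleAll fun i => (f i).map (h i) := by
  simp only [← PMF.bind_pure_comp, Function.comp_def, ← sampleAll_bind, sampleAll_pure]

/-- Two consecutive rounds of independent sampling, followed by a function of the pairs. -/
theorem sampleAll_bind_bind {n : ℕ} (f : Fin n → PMF α) (g : Fin n → α → PMF β)
    (h : Fin n → α → β → γ) {δ : Type} (k : (Fin n → γ) → PMF δ) :
    ((sampleAll f).bind fun a => (sampleAll fun i => g i (a i)).bind fun b =>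
        k fun i => h i (a i) (b i)) =
      (sampleAll fun i => (f i).bind fun a => (g i a).map (h i a)).bind k := by
  rw [← sampleAll_bind, PMF.bind_bind]
  refine congrArg _ (funext fun a => ?_)
  rw [← sampleAll_map, PMF.bind_map]
  rfl

theorem mem_support_sampleAll {n : ℕ} {f : Fin n → PMF α} {a : Fin n → α}
    (h : a ∈ (sampleAll f).support) (i : Fin n) : a i ∈ (f i).support := by
  induction n with
  | zero => exact i.elim0
  | succ n ih =>
    simp only [sampleAll, PMF.mem_support_bind_iff, PMF.mem_support_pure_iff] at h
    obtain ⟨b, hb, r, hr, rfl⟩ := h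
    refine Fin.cases ?_ (fun j => ?_) i
    · simpa using hb
    · simpa using ih hr j

/-- Correctness of signatures is known only for keys and signatures that can actually occur, so
continuations are compared on supports. -/
theorem bind_congr_support {p : PMF α} {f g : α → PMF β} (h : ∀ a ∈ p.support, f a = g a) :
    p.bind f = p.bind g := by
  ext b
  simp only [PMF.bind_apply]
  refine tsum_congr fun a => ?_
  by_cases ha : a ∈ p.support
  · rw [h a ha]
  · simp [(PMF.apply_eq_zero_iff _ _).2 ha]

end Sampling

/-! ## Programs without their step count -/

section Denotation

variable (S : Setting) (C : Finset (Fin S.n)) (M : Adversary S)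

/-- The distribution of the result of a program. -/
def Prog.den : {Γ : List Ty} → {a : Ty} → Prog Γ a → Env S M Γ → PMF (a.Val S M)
  | _, _, .var v, e => PMF.pure (v.lookup S M e)
  | _, _, .op o p, e => (p.den e).bind fun u => o.eval S C M u
  | _, _, .bind p r, e => (p.den e).bind fun u => r.den (u, e)
  | _, _, .unit, _ => PMF.pure ()
  | _, _, .pair p r, e => (p.den e).bind fun u => (r.den e).bind fun w => PMF.pure (u, w)
  | _, _, .fst p, e => (p.den e).bind fun u => PMF.pure u.1
  | _, _, .snd p, e => (p.den e).bind fun u => PMF.pure u.2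
  | _, _, .ite c p r, e => (c.den e).bind fun b => if b = true then p.den e else r.den e
  | _, _, .none, _ => PMF.pure Option.none
  | _, _, .some p, e => (p.den e).bind fun u => PMF.pure (Option.some u)
  | _, _, .case p r s, e => (p.den e).bind fun u => u.elim (r.den e) fun z => s.den (z, e)
  | _, _, .tab p, e => sampleAll fun i : Fin S.n => p.den (i, e)
  | _, _, .get p r, e => (p.den e).bind fun u => (r.den e).bind fun w => PMF.pure (u w)

/-- The step counter never influences a result. Views can therefore be computed with `den`, where
the bookkeeping is gone. -/
theorem Prog.map_fst_run {Γ : List Ty} {a : Ty} (p : Prog Γ a) (e : Env S M Γ) :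
    (p.run S C M e).map Prod.fst = p.den S C M e := by
  induction p with
  | var v => simp [run, den, PMF.pure_map]
  | unit => simp [run, den, PMF.pure_map]
  | none => simp [run, den, PMF.pure_map]
  | op o p ih =>
    simp only [run, den, ← ih, PMF.map_bind, PMF.pure_map, PMF.bind_map, Function.comp_def,
      PMF.bind_pure]
  | bind p r ih ih' =>
    simp only [run, den, ← ih, ← ih', PMF.map_bind, PMF.pure_map, PMF.bind_map, Function.comp_def]
    rfl
  | pair p r ih ih' =>
    simp only [run, den, ← ih, ← ih', PMF.map_bind, PMF.pure_map, PMF.bind_map, Function.comp_def]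
  | fst p ih =>
    simp only [run, den, ← ih, PMF.map_bind, PMF.pure_map, PMF.bind_map, Function.comp_def]
  | snd p ih =>
    simp only [run, den, ← ih, PMF.map_bind, PMF.pure_map, PMF.bind_map, Function.comp_def]
  | some p ih =>
    simp only [run, den, ← ih, PMF.map_bind, PMF.pure_map, PMF.bind_map, Function.comp_def]
  | ite c p r ihc ih ih' =>
    simp only [run, den, ← ihc, ← ih, ← ih', PMF.map_bind, PMF.pure_map, PMF.bind_map,
      Function.comp_def]
    refine congrArg _ (funext fun b => ?_)
    split <;> rfl
  | case p r s ih ihr ihs =>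
    simp only [run, den, ← ih, PMF.map_bind, PMF.pure_map, PMF.bind_map,
      Function.comp_def]
    refine congrArg _ (funext fun b => ?_)
    obtain ⟨_ | z, k⟩ := b
    · exact ihr e
    · exact ihs (z, e)
  | tab p ih =>
    simp only [run, den, ← ih, PMF.map_bind, PMF.pure_map]
    rw [← sampleAll_map]
    rfl
  | get p r ih ih' =>
    simp only [run, den, ← ih, ← ih', PMF.map_bind, PMF.pure_map, PMF.bind_map, Function.comp_def]

theorem Prog.run_bind {Γ : List Ty} {a : Ty} {β : Type} (p : Prog Γ a) (e : Env S M Γ)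
    (f : a.Val S M → PMF β) :
    ((p.run S C M e).bind fun u => f u.1) = (p.den S C M e).bind f := by
  rw [← map_fst_run, PMF.bind_map]; rfl

end Denotation

/-! ## Polynomial running time -/

/-- The parameter in which running times are measured. -/
def timeParam (S : Setting) (M : Adversary S) : ℕ := S.κ + S.n + S.m + S.callTime + M.time

/-- The exponent 3 comes from `share`, which is charged `n * t * (callTime + 1)` with `t < n`; all
other operations are at most quadratic. -/
theorem Op.cost_le {a b : Ty} (o : Op a b) (S : Setting) (M : Adversary S) :
    o.cost S M ≤ (timeParam S M + 1) ^ 3 := by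
  set N := timeParam S M with hN
  have hn : S.n ≤ N := by simp only [hN, timeParam]; omega
  have hm : S.m + 1 ≤ N + 1 := by simp only [hN, timeParam]; omega
  have hc : S.callTime + 1 ≤ N + 1 := by simp only [hN, timeParam]; omega
  have hM : M.time + 1 ≤ N + 1 := by simp only [hN, timeParam]; omega
  have ht : S.t ≤ N + 1 := by have := S.t_lt; omega
  have h1 : N + 1 ≤ (N + 1) ^ 3 := Nat.le_self_pow (by norm_num) _
  have h2 : (N + 1) ^ 2 ≤ (N + 1) ^ 3 := Nat.pow_le_pow_right (by omega) (by norm_num)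
  have hsh : S.n * S.t * (S.callTime + 1) ≤ (N + 1) ^ 3 := by
    calc _ ≤ (N + 1) * (N + 1) * (N + 1) :=
          Nat.mul_le_mul (Nat.mul_le_mul (by omega) ht) hc
      _ = _ := by ring
  have hv : (S.m + 1) * (S.callTime + 1) ≤ (N + 1) ^ 3 := by
    calc _ ≤ (N + 1) * (N + 1) := Nat.mul_le_mul hm hc
      _ ≤ _ := by rw [← sq]; exact h2
  cases o <;> simp only [Op.cost] <;> omega

/-- Every program runs in polynomial time. -/
theorem Prog.exists_steps_le {Γ : List Ty} {a : Ty} (p : Prog Γ a) :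
    ∃ P : Polynomial ℕ, ∀ (S : Setting) (C : Finset (Fin S.n)) (M : Adversary S) (e : Env S M Γ),
      ∀ w ∈ (p.run S C M e).support, w.2 ≤ P.eval (timeParam S M) := by
  induction p with
  | var v => exact ⟨1, fun S C M e w hw => by simp_all [run]⟩
  | unit => exact ⟨1, fun S C M e w hw => by simp_all [run]⟩
  | none => exact ⟨1, fun S C M e w hw => by simp_all [run]⟩
  | op o p ih =>
    obtain ⟨P, hP⟩ := ih
    refine ⟨P + (Polynomial.X + 1) ^ 3 + 1, fun S C M e w hw => ?_⟩
    simp only [run, PMF.mem_support_bind_iff, PMF.mem_support_pure_iff] at hw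
    obtain ⟨u, hu, v, hv, rfl⟩ := hw
    have := hP S C M e u hu
    have := o.cost_le S M
    simp only [Polynomial.eval_add, Polynomial.eval_pow, Polynomial.eval_X, Polynomial.eval_one]
    omega
  | bind p r ih ih' =>
    obtain ⟨P, hP⟩ := ih
    obtain ⟨R, hR⟩ := ih'
    refine ⟨P + R + 1, fun S C M e w hw => ?_⟩
    simp only [run, PMF.mem_support_bind_iff, PMF.mem_support_pure_iff] at hw
    obtain ⟨u, hu, v, hv, rfl⟩ := hw
    have := hP S C M e u hu
    have := hR S C M _ v hv
    simp only [Polynomial.eval_add, Polynomial.eval_one]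
    omega
  | pair p r ih ih' =>
    obtain ⟨P, hP⟩ := ih
    obtain ⟨R, hR⟩ := ih'
    refine ⟨P + R + 1, fun S C M e w hw => ?_⟩
    simp only [run, PMF.mem_support_bind_iff, PMF.mem_support_pure_iff] at hw
    obtain ⟨u, hu, v, hv, rfl⟩ := hw
    have := hP S C M e u hu
    have := hR S C M _ v hv
    simp only [Polynomial.eval_add, Polynomial.eval_one]
    omega
  | get p r ih ih' =>
    obtain ⟨P, hP⟩ := ih
    obtain ⟨R, hR⟩ := ih'
    refine ⟨P + R + 1, fun S C M e w hw => ?_⟩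
    simp only [run, PMF.mem_support_bind_iff, PMF.mem_support_pure_iff] at hw
    obtain ⟨u, hu, v, hv, rfl⟩ := hw
    have := hP S C M e u hu
    have := hR S C M _ v hv
    simp only [Polynomial.eval_add, Polynomial.eval_one]
    omega
  | fst p ih =>
    obtain ⟨P, hP⟩ := ih
    refine ⟨P + 1, fun S C M e w hw => ?_⟩
    simp only [run, PMF.mem_support_bind_iff, PMF.mem_support_pure_iff] at hw
    obtain ⟨u, hu, rfl⟩ := hw
    simpa using hP S C M e u hu
  | snd p ih =>
    obtain ⟨P, hP⟩ := ih
    refine ⟨P + 1, fun S C M e w hw => ?_⟩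
    simp only [run, PMF.mem_support_bind_iff, PMF.mem_support_pure_iff] at hw
    obtain ⟨u, hu, rfl⟩ := hw
    simpa using hP S C M e u hu
  | some p ih =>
    obtain ⟨P, hP⟩ := ih
    refine ⟨P + 1, fun S C M e w hw => ?_⟩
    simp only [run, PMF.mem_support_bind_iff, PMF.mem_support_pure_iff] at hw
    obtain ⟨u, hu, rfl⟩ := hw
    simpa using hP S C M e u hu
  | ite c p r ihc ih ih' =>
    obtain ⟨Q, hQ⟩ := ihc
    obtain ⟨P, hP⟩ := ih
    obtain ⟨R, hR⟩ := ih'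
    -- The sum of the two branch bounds replaces their maximum, which need not be a polynomial.
    refine ⟨Q + P + R + 1, fun S C M e w hw => ?_⟩
    simp only [run, PMF.mem_support_bind_iff, PMF.mem_support_pure_iff] at hw
    obtain ⟨u, hu, v, hv, rfl⟩ := hw
    have := hQ S C M e u hu
    simp only [Polynomial.eval_add, Polynomial.eval_one]
    split at hv
    · have := hP S C M e v hv
      omega
    · have := hR S C M e v hv
      omega
  | case p r s ih ihr ihs =>
    obtain ⟨Q, hQ⟩ := ih
    obtain ⟨P, hP⟩ := ihr
    obtain ⟨R, hR⟩ := ihs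
    refine ⟨Q + P + R + 1, fun S C M e w hw => ?_⟩
    simp only [run, PMF.mem_support_bind_iff, PMF.mem_support_pure_iff] at hw
    obtain ⟨⟨_ | z, k⟩, hu, v, hv, rfl⟩ := hw
    · have := hQ S C M e _ hu
      have := hP S C M e v hv
      simp only [Polynomial.eval_add, Polynomial.eval_one]
      omega
    · have := hQ S C M e _ hu
      have := hR S C M _ v hv
      simp only [Polynomial.eval_add, Polynomial.eval_one]
      omega
  | tab p ih =>
    obtain ⟨P, hP⟩ := ih
    -- At most `X` iterations of the body, plus the overhead `n + 1` of the loop.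
    refine ⟨Polynomial.X * P + Polynomial.X + 1, fun S C M e w hw => ?_⟩
    simp only [run, PMF.mem_support_bind_iff, PMF.mem_support_pure_iff] at hw
    obtain ⟨r, hr, rfl⟩ := hw
    have hn : S.n ≤ timeParam S M := by simp only [timeParam]; omega
    have hs : ∑ i, (r i).2 ≤ timeParam S M * P.eval (timeParam S M) := by
      refine (Finset.sum_le_card_nsmul _ _ _ fun i _ =>
        hP S C M _ _ (mem_support_sampleAll hr i)).trans ?_
      simpa using Nat.mul_le_mul_right _ hn
    simp only [Polynomial.eval_add, Polynomial.eval_mul, Polynomial.eval_X, Polynomial.eval_one]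
    omega

/-- Every simulator runs in polynomial time. -/
theorem Simulator.exists_steps_le (sim : Simulator) :
    ∃ p : Polynomial ℕ, ∀ (S : Setting) (C : Finset (Fin S.n)) (M : Adversary S)
      (x : {i : Fin S.n // i ∉ C} → Fin S.m → ZMod S.q), ∀ o ∈ (ideal S C M sim x).support,
        o.steps ≤ p.eval (S.κ + S.n + S.m + S.callTime + M.time) := by
  obtain ⟨P, hP⟩ := sim.first.exists_steps_le
  obtain ⟨Q, hQ⟩ := sim.second.exists_steps_le
  obtain ⟨R, hR⟩ := sim.third.exists_steps_le
  refine ⟨P + Q + R, fun S C M x o ho => ?_⟩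
  simp only [ideal, bind, PMF.mem_support_bind_iff, PMF.mem_support_pure_iff] at ho
  obtain ⟨_, _, a, ha, d, _, b, hb, c, hc, rfl⟩ := ho
  have := hP S C M _ a ha
  have := hQ S C M _ b hb
  have := hR S C M _ c hc
  simp only [timeParam] at *
  simp only [Polynomial.eval_add]
  omega

/-! ## The simulator -/

namespace Prog

variable {Γ : List Ty} {a b a0 a1 a2 a3 a4 a5 a6 a7 a8 a9 : Ty}

/-! `xk` is the `k`-th variable, counted from the innermost binder. -/

abbrev x0 : Prog (a0 :: Γ) a0 := .var .here
abbrev x1 : Prog (a0 :: a1 :: Γ) a1 := .var (.there .here)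
abbrev x2 : Prog (a0 :: a1 :: a2 :: Γ) a2 := .var (.there (.there .here))
abbrev x3 : Prog (a0 :: a1 :: a2 :: a3 :: Γ) a3 := .var (.there (.there (.there .here)))
abbrev x4 : Prog (a0 :: a1 :: a2 :: a3 :: a4 :: Γ) a4 :=
  .var (.there (.there (.there (.there .here))))
abbrev x5 : Prog (a0 :: a1 :: a2 :: a3 :: a4 :: a5 :: Γ) a5 :=
  .var (.there (.there (.there (.there (.there .here)))))
abbrev x6 : Prog (a0 :: a1 :: a2 :: a3 :: a4 :: a5 :: a6 :: Γ) a6 :=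
  .var (.there (.there (.there (.there (.there (.there .here))))))
abbrev x7 : Prog (a0 :: a1 :: a2 :: a3 :: a4 :: a5 :: a6 :: a7 :: Γ) a7 :=
  .var (.there (.there (.there (.there (.there (.there (.there .here)))))))
abbrev x8 : Prog (a0 :: a1 :: a2 :: a3 :: a4 :: a5 :: a6 :: a7 :: a8 :: Γ) a8 :=
  .var (.there (.there (.there (.there (.there (.there (.there (.there .here))))))))
abbrev x9 : Prog (a0 :: a1 :: a2 :: a3 :: a4 :: a5 :: a6 :: a7 :: a8 :: a9 :: Γ) a9 :=
  .var (.there (.there (.there (.there (.there (.there (.there (.there (.there .here)))))))))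

abbrev tt : Prog Γ .bool := .op .tru .unit
abbrev neg (p : Prog Γ .bool) : Prog Γ .bool := .op .not p
abbrev ff : Prog Γ .bool := neg tt
abbrev conj (p r : Prog Γ .bool) : Prog Γ .bool := .op .and (.pair p r)
abbrev disj (p r : Prog Γ .bool) : Prog Γ .bool := .op .or (.pair p r)
abbrev imp (p r : Prog Γ .bool) : Prog Γ .bool := disj (neg p) r
abbrev eqc (p r : Prog Γ .client) : Prog Γ .bool := .op .eqClient (.pair p r)
abbrev corr (p : Prog Γ .client) : Prog Γ .bool := .op .corrupted p
abbrev present (p : Prog Γ (.opt a)) : Prog Γ .bool := .case p ff tt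
abbrev get2 (p : Prog Γ (.arr (.arr a))) (i j : Prog Γ .client) : Prog Γ a := .get (.get p i) j

end Prog

/-! ### States and messages of the simulator -/

namespace Ty

/-- Signature keys of the clients, encryption keys of the clients, keys of the server. -/
abbrev keys : Ty :=
  prod (arr (prod ssk spk)) (prod (arr (prod csk cpk)) (prod (prod ssk spk) (prod csk cpk)))

/-- The coins of the next-message algorithm and all keys. -/
abbrev start : Ty := prod coins keys

/-- What the corrupted clients receive from the trusted party in the first activation. -/
abbrev leak : Ty := opt (prod set (arr (arr (opt field))))

/-- The messages of corrupted clients, and connections between honest clients, in step 1. -/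
abbrev sent1 : Ty := prod (arr set) (arr (arr (opt (prod ct sig))))

abbrev sent2 : Ty := prod set (arr (opt (prod vec sig)))

/-- The view up to the list `U₂`, the signatures on it, the delivered messages of step 1, and the
initial data. -/
abbrev middle : Ty := prod view3 (prod (arr (opt sig)) (prod (arr set) start))

end Ty

namespace Sim

open Prog

/-- First activation: all honest clients are connected, the corrupted ones hand in random seeds. -/
def first : Prog [] (.prod (.prod .set (.arr (.opt .seed))) .start) :=
  -- The trusted party's `U₁` thus consists of all clients and it cannot abort here. The delivery
  -- condition defining `U₁` in the protocol is known only after the adversary has been run, and is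
  -- imposed later as part of `U₂`.
  .pair (.pair (.tab tt) (.tab (.some (.op .randSeed .unit))))
    (.pair (.op .coins .unit)
      (.pair (.tab (.op .sigKeygen .unit)) (.pair (.tab (.op .encKeygen .unit))
        (.pair (.op .sigKeygen .unit) (.op .encKeygen .unit)))))

/-- What the corrupted clients know before the protocol. -/
def view0 : Prog [.leak, .start] .view0 :=
  .pair (.fst x1)
    (.pair (.tab (.snd (.get (.fst (.snd x2)) x0)))
      (.pair (.tab (.snd (.get (.fst (.snd (.snd x2))) x0)))
        (.pair (.snd (.fst (.snd (.snd (.snd x1)))))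
          (.pair (.snd (.snd (.snd (.snd (.snd x1)))))
            (.tab (.ite (corr x0)
              (.some (.pair (.fst (.get (.fst (.snd x2)) x0))
                (.fst (.get (.fst (.snd (.snd x2))) x0))))
              .none))))))

/-- The share of the seed of the client `x1` for the client `x0`, as received from the trusted
party. -/
def leakedShare {Γ : List Ty} {a b c : Ty} :
    Prog (.client :: .client :: a :: b :: .leak :: c :: Γ) .field :=
  -- The defaults 0 are harmless: for a corrupted receiver the share is always present, and other
  -- entries are not put into the view.
  .case x4 (.op .zero .unit) (.case (get2 (.snd x0) x2 x1) (.op .zero .unit) x0)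

/-- The signed ciphertext from the client `x1` to the client `x0`. -/
def cipherMsg {Γ : List Ty} {a b : Ty} :
    Prog (.client :: .client :: a :: b :: .leak :: .start :: Γ) (.prod .ct .sig) :=
  .bind (.op .enc (.pair (.snd (.get (.fst (.snd (.snd x5))) x0)) leakedShare))
    (.pair x0 (.op .signCipher (.pair (.fst (.get (.fst (.snd x6)) x2)) x0)))

/-- The view after step 1. -/
def view1 : Prog [.leak, .start] .view1 :=
  .bind view0 (.bind (.op .deliver1 x0)
    (.pair x1 (.tab (.tab
      (.ite (conj (neg (corr x1)) (conj (corr x0) (get2 x2 x1 x0)))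
        (.some cipherMsg) .none)))))

/-- Which messages of step 1 are delivered. -/
def arrived : Prog [.sent1, .view1, .leak, .start] (.arr .set) :=
  .tab (.tab (.ite (corr x1) (present (get2 (.snd x2) x1 x0))
    (.ite (corr x0) (present (get2 (.snd x3) x1 x0))
      (disj (eqc x1 x0) (get2 (.fst x2) x1 x0)))))

/-- The clients whose masked models are accepted by the server. -/
def accepted : Prog [.sent2, .arr .set, .sent1, .view1, .leak, .start] .set :=
  .tab (conj
    (.op .atLeastT (.tab (conj (neg (eqc x0 x1)) (get2 x3 x1 x0))))
    (.ite (corr x0)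
      (.case (.get (.snd x1) x0) ff
        (.op .verifyMasked (.pair (.snd (.get (.fst (.snd x7)) x1)) x0)))
      (conj
        (.op .all (.tab (.ite (corr x0)
          (.case (get2 (.snd x4) x0 x1) tt
            (.op .verifyCipher (.pair (.snd (.get (.fst (.snd x8)) x1)) x0)))
          tt)))
        (.get (.fst x1) x0))))

/-- The signatures on the list of accepted clients. -/
def confirmations :
    Prog [.view3, .set, .sent2, .arr .set, .sent1, .view1, .leak, .start] (.arr (.opt .sig)) :=
  .bind (.op .send3 x0)
    (.tab (.ite (corr x0) (.get (.snd x1) x0)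
      (.ite (conj (.get x3 x0) (conj (.get (.fst x1) x0)
          (.op .verifyClients (.pair (.fst (.snd (.snd (.snd (.fst (.fst x2))))))
            (.pair x3 (.snd (.snd x2)))))))
        (.some (.op .signClients (.pair (.fst (.get (.fst (.snd x9)) x0))
          x3)))
        .none)))

/-- Second activation: the run is simulated up to the signatures on `U₂`; the trusted party gets
the connection schedule and the masked models of that run. -/
def second : Prog [.leak, .start]
    (.prod (.prod (.prod .set (.arr (.opt .vec))) .set) .middle) :=
  .bind view1 (.bind (.op .send1 x0) (.bind arrived (.bind (.op .send2 x2) (.bind accepted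
    (.bind (.pair x4 (.pair x0 (.op .signClients (.pair (.fst (.fst (.snd (.snd (.snd x6))))) x0))))
      (.bind confirmations
        (.pair
          (.pair
            -- The trusted party checks no signatures, so the simulated `U₂` itself serves as the
            -- set of connected honest clients, and models of corrupted clients outside `U₂` are
            -- withheld.
            (.pair x2 (.tab (.ite (.get x3 x0)
              (.case (.get (.snd x4) x0) .none (.some (.fst x0))) .none)))
            (.tab (present (.get x1 x0))))
          (.pair x1 (.pair x0 (.pair x4 x8))))))))))

/-- The view at the end, from the list of the clients that stay connected. -/
def finalView : Prog [.opt .set, .middle] .view :=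
  .pair (.fst x1)
    (.case x0 .none
      -- The trusted party reveals `U₃` once `U₂` contains a corrupted client, whereas the server
      -- forwards signatures only if `U₃` contains one. The existential test is written as a negated
      -- `all`.
      (.ite (neg (.op .all (.tab (neg (conj (corr x0) (.get x1 x0))))))
        (.some (.tab (.ite (.get x1 x0) (.get (.fst (.snd x3)) x0) .none)))
        .none))

/-- The clients that stay connected for the unmasking. -/
def confirmed : Prog [.view, .opt .set, .middle] .set :=
  .tab (conj (.get (.fst (.snd (.fst x1))) x0) (present (.get (.fst (.snd x3)) x0)))

/-- Whether all signatures on the list of accepted clients are valid. -/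
def consistent : Prog [.set, .view, .opt .set, .middle] .bool :=
  .op .all (.tab (imp (.get x1 x0) (.case (.get (.fst (.snd x4)) x0) ff
    (.op .verifyClients (.pair (.get (.fst (.snd (.fst (.fst (.fst x5))))) x1)
      (.pair (.fst (.snd (.fst x5))) x0))))))

/-- The honest clients that send a share for unmasking, and the shares of the corrupted ones. -/
def unmasking : Prog [.view, .opt .set, .middle] (.prod .set (.arr (.opt .field))) :=
  .bind confirmed (.bind consistent (.bind (.op .send4 x2)
    (.pair
      (.tab (conj (.get (.fst x1) x0) (conj x2
        (.op .all (.tab (imp (.get x4 x0) (get2 (.fst (.snd (.snd x7))) x0 x1)))))))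
      (.tab (.case (.get (.snd x1) x0) .none
        (.ite (.op .verifyCipher (.pair (.get (.fst (.snd (.fst (.fst (.fst x7))))) x1) x0))
          (.some (.op .dec (.pair
            (.fst (.snd (.snd (.snd (.snd (.snd (.snd (.snd x7)))))))) (.fst x0))))
          .none))))))

/-- Third activation: the view is completed with the list received from the trusted party, which
gets the shares for unmasking of the simulated run. -/
def third : Prog [.opt .set, .middle] (.prod (.prod .set (.arr (.opt .field))) .view) :=
  .bind finalView (.pair unmasking x0)

end Sim

/-- The simulator: it runs the next-message algorithm with honestly generated keys and with the
shares received from the trusted party. -/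
def simulator : Simulator where
  state1 := .start
  state2 := .middle
  first := Sim.first
  second := Sim.second
  third := Sim.third

section Views

variable (S : Setting) (C : Finset (Fin S.n)) (M : Adversary S)

/-! ## The view in closed form -/

/-- The view before the protocol, for given coins and keys. -/
def initialView (ρ : M.Coins) (sk : Fin S.n → S.SSK × S.SPK) (ck : Fin S.n → S.CSK × S.CPK)
    (sks : S.SSK × S.SPK) (cks : S.CSK × S.CPK) : S.View0 M.Coins :=
  (ρ, fun i => (sk i).2, fun i => (ck i).2, sks.2, cks.2,
    fun i => if i ∈ C then some ((sk i).1, (ck i).1) else none)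

/-- The messages from honest to corrupted clients in step 1, for given shares. -/
def cipherDist (v0 : S.View0 M.Coins) (sk : Fin S.n → S.SSK × S.SPK)
    (ck : Fin S.n → S.CSK × S.CPK) (sh : Fin S.n → Fin S.n → ZMod S.P) : PMF S.Msg1 :=
  sampleAll fun i => sampleAll fun j =>
    if i ∉ C ∧ j ∈ C ∧ M.deliver1 v0 i j then
      (S.encr.enc (ck j).2 (sh i j)).bind fun c =>
        (S.sign.sign (sk i).1 (.cipher c)).bind fun σ => PMF.pure (some (c, σ))
    else PMF.pure none

/-- Which messages of step 1 are delivered. -/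
def delivered (v1 : S.View1 M.Coins) (i j : Fin S.n) : Bool :=
  if i ∈ C then ((M.send1 v1).2 i j).isSome
  else if j ∈ C then (v1.2 i j).isSome
  else decide (i = j) || (M.send1 v1).1 i j

/-- The clients whose masked models are accepted by the server. -/
def acceptedClients (pk : Fin S.n → S.SPK) (v1 : S.View1 M.Coins) : ClientSet S.n := fun i =>
  decide (S.t ≤ size fun j => !decide (j = i) && delivered S C M v1 i j) &&
  if i ∈ C then
    ((M.send2 v1).2 i).elim false fun p => S.sign.verify (pk i) (.masked p.1) p.2
  else
    decide (∀ j, (if j ∈ C then ((M.send1 v1).2 j i).elim true fun p =>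
      S.sign.verify (pk j) (.cipher p.1) p.2 else true) = true) && (M.send2 v1).1 i

/-- The signatures on the list of accepted clients. -/
def confirmDist (sk : Fin S.n → S.SSK × S.SPK) (spk : S.SPK) (v3 : S.View3 M.Coins) :
    PMF (Fin S.n → Option S.Sig) :=
  sampleAll fun i =>
    if i ∈ C then PMF.pure ((M.send3 v3).2 i)
    else if v3.2.1 i && ((M.send3 v3).1 i && S.sign.verify spk (.clients v3.2.1) v3.2.2) then
      (S.sign.sign (sk i).1 (.clients v3.2.1)).bind fun σ => PMF.pure (some σ)
    else PMF.pure none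

/-- The clients whose confirmations arrived. -/
def confirmedClients (U2 : ClientSet S.n) (up3 : Fin S.n → Option S.Sig) : ClientSet S.n :=
  fun i => U2 i && (up3 i).isSome

/-- The forwarded confirmations. -/
def forwarded (U3 : ClientSet S.n) (up3 : Fin S.n → Option S.Sig) : S.Msg4 :=
  if S.t ≤ size U3 ∧ ∃ j ∈ C, U3 j then some fun i => if U3 i then up3 i else none else none

/-- The view after step 1, for given coins, keys and shares. -/
def viewDist1 (ρ : M.Coins) (sk : Fin S.n → S.SSK × S.SPK) (ck : Fin S.n → S.CSK × S.CPK)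
    (sks : S.SSK × S.SPK) (cks : S.CSK × S.CPK) (sh : Fin S.n → Fin S.n → ZMod S.P) :
    PMF (S.View1 M.Coins) :=
  (cipherDist S C M (initialView S C M ρ sk ck sks cks) sk ck sh).bind fun msg1 =>
    PMF.pure (initialView S C M ρ sk ck sks cks, msg1)

/-- The view at the end and the signatures of step 3, continuing a view after step 1. -/
def continuation {β : Type} (sk : Fin S.n → S.SSK × S.SPK) (sks : S.SSK × S.SPK)
    (v1 : S.View1 M.Coins) (k : S.View3 M.Coins → (Fin S.n → Option S.Sig) → PMF β) : PMF β :=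
  (S.sign.sign sks.1 (.clients (acceptedClients S C M (fun i => (sk i).2) v1))).bind fun σ3 =>
    (confirmDist S C M sk sks.2
      (v1, (acceptedClients S C M (fun i => (sk i).2) v1, σ3))).bind fun up3 =>
      k (v1, (acceptedClients S C M (fun i => (sk i).2) v1, σ3)) up3

/-- The view at the end. -/
def endView (v3 : S.View3 M.Coins) (up3 : Fin S.n → Option S.Sig) : S.View M.Coins :=
  (v3, forwarded S C (confirmedClients S v3.2.1 up3) up3)

/-- The distribution of the coins of the next-message algorithm and of all keys. -/
def startDist : PMF (Ty.start.Val S M) :=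
  M.coins.bind fun ρ =>
  (sampleAll fun _ : Fin S.n => S.sign.keygen).bind fun sk =>
  (sampleAll fun _ : Fin S.n => S.encr.keygen).bind fun ck =>
  S.sign.keygen.bind fun sks =>
  S.encr.keygen.bind fun cks =>
  PMF.pure (ρ, sk, ck, sks, cks)

/-- The distribution of the view for given coins, keys and shares. -/
def viewDistFrom (st : Ty.start.Val S M) (sh : Fin S.n → Fin S.n → ZMod S.P) :
    PMF (S.View M.Coins) :=
  (viewDist1 S C M st.1 st.2.1 st.2.2.1 st.2.2.2.1 st.2.2.2.2 sh).bind fun v1 =>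
    continuation S C M st.2.1 st.2.2.2.1 v1 fun v3 up3 => PMF.pure (endView S C M v3 up3)

/-- The distribution of the view, without any reference to the inputs of the honest clients. -/
def viewDist : PMF (S.View M.Coins) :=
  (startDist S M).bind fun st =>
  (sampleAll fun _ : Fin S.n => S.randSeed.bind S.share).bind fun sh =>
  viewDistFrom S C M st sh

/-! ## The programs of the simulator -/

variable {S C M}

theorem elim_pure {α β : Type} (o : Option α) (b : β) (f : α → β) :
    (o.elim (PMF.pure b) fun z => PMF.pure (f z)) = PMF.pure (o.elim b f) := by
  cases o <;> rfl

theorem ite_pure {α : Type} (c : Prop) [Decidable c] (a b : α) :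
    (if c then PMF.pure a else PMF.pure b) = PMF.pure (if c then a else b) :=
  (apply_ite PMF.pure _ _ _).symm

theorem den_view0 (l : Ty.leak.Val S M) (ρ : M.Coins) (sk : Fin S.n → S.SSK × S.SPK)
    (ck : Fin S.n → S.CSK × S.CPK) (sks : S.SSK × S.SPK) (cks : S.CSK × S.CPK) :
    Sim.view0.den S C M (l, (ρ, sk, ck, sks, cks), ()) =
      PMF.pure (initialView S C M ρ sk ck sks cks) := by
  simp [Sim.view0, Prog.den, Var.lookup, Op.eval, PMF.pure_bind, sampleAll_pure, ite_pure,
    initialView]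

theorem elim_isSome {α : Type} (o : Option α) : (o.elim false fun _ => true) = o.isSome := by
  cases o <;> rfl

/-- The shares that the simulator uses: those received from the trusted party, if any. -/
def usedShare (l : Ty.leak.Val S M) (i j : Fin S.n) : ZMod S.P :=
  l.elim 0 fun r => (r.2 i j).elim 0 id

theorem den_leakedShare {a b : Ty} (i j : Fin S.n) (u : a.Val S M) (w : b.Val S M)
    (l : Ty.leak.Val S M) (st : Ty.start.Val S M) :
    (Sim.leakedShare (Γ := [])).den S C M (j, i, u, w, l, st, ()) = PMF.pure (usedShare l i j) := by
  simp only [Sim.leakedShare, Prog.den, Var.lookup, Op.eval, PMF.pure_bind]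
  obtain _ | r := l
  · rfl
  · exact elim_pure (r.2 i j) 0 id

theorem den_cipherMsg {a b : Ty} (i j : Fin S.n) (u : a.Val S M) (w : b.Val S M)
    (l : Ty.leak.Val S M) (ρ : M.Coins) (sk : Fin S.n → S.SSK × S.SPK)
    (ck : Fin S.n → S.CSK × S.CPK) (sks : S.SSK × S.SPK) (cks : S.CSK × S.CPK) :
    (Sim.cipherMsg (Γ := [])).den S C M (j, i, u, w, l, (ρ, sk, ck, sks, cks), ()) =
      (S.encr.enc (ck j).2 (usedShare l i j)).bind fun c =>
        (S.sign.sign (sk i).1 (.cipher c)).bind fun σ => PMF.pure (c, σ) := by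
  simp only [Sim.cipherMsg, Prog.den, Var.lookup, Op.eval, PMF.pure_bind]
  erw [den_leakedShare]
  simp only [PMF.pure_bind]

theorem den_view1 (l : Ty.leak.Val S M) (ρ : M.Coins) (sk : Fin S.n → S.SSK × S.SPK)
    (ck : Fin S.n → S.CSK × S.CPK) (sks : S.SSK × S.SPK) (cks : S.CSK × S.CPK) :
    Sim.view1.den S C M (l, (ρ, sk, ck, sks, cks), ()) =
      viewDist1 S C M ρ sk ck sks cks (usedShare l) := by
  simp only [Sim.view1, Prog.den, Op.eval, Var.lookup, PMF.pure_bind]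
  erw [den_view0, PMF.pure_bind]
  refine congrArg₂ PMF.bind
    (congrArg sampleAll (funext fun i => congrArg sampleAll (funext fun j => ?_))) rfl
  erw [den_cipherMsg]
  simp only [PMF.bind_bind, PMF.pure_bind]
  by_cases h : i ∈ C <;> by_cases h' : j ∈ C <;> simp [h, h']

theorem den_arrived (v1 : S.View1 M.Coins) (l : Ty.leak.Val S M) (st : Ty.start.Val S M) :
    Sim.arrived.den S C M (M.send1 v1, v1, l, st, ()) = PMF.pure (delivered S C M v1) := by
  simp only [Sim.arrived, Prog.den, Var.lookup, Op.eval, PMF.pure_bind, sampleAll_pure, ite_pure,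
    elim_pure, elim_isSome, decide_eq_true_eq, Bool.not_true]
  rfl

theorem den_accepted (v1 : S.View1 M.Coins) (l : Ty.leak.Val S M) (ρ : M.Coins)
    (sk : Fin S.n → S.SSK × S.SPK) (k : (Ty.prod (.arr (.prod .csk .cpk))
      (.prod (.prod .ssk .spk) (.prod .csk .cpk))).Val S M) :
    Sim.accepted.den S C M
        (M.send2 v1, delivered S C M v1, M.send1 v1, v1, l, (ρ, sk, k), ()) =
      PMF.pure (acceptedClients S C M (fun i => (sk i).2) v1) := by
  simp only [Sim.accepted, Prog.den, Var.lookup, Op.eval, PMF.pure_bind, sampleAll_pure, ite_pure,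
    elim_pure, decide_eq_true_eq, Bool.not_true]
  rfl

theorem den_confirmations (v3 : S.View3 M.Coins) (s2 : Ty.sent2.Val S M)
    (arr : (Ty.arr .set).Val S M) (s1 : Ty.sent1.Val S M) (v1 : S.View1 M.Coins)
    (l : Ty.leak.Val S M) (ρ : M.Coins) (sk : Fin S.n → S.SSK × S.SPK)
    (k : (Ty.prod (.arr (.prod .csk .cpk)) (.prod (.prod .ssk .spk) (.prod .csk .cpk))).Val S M) :
    Sim.confirmations.den S C M (v3, v3.2.1, s2, arr, s1, v1, l, (ρ, sk, k), ()) =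
      confirmDist S C M sk v3.1.1.2.2.2.1 v3 := by
  simp only [Sim.confirmations, Prog.den, Var.lookup, Op.eval, PMF.pure_bind, decide_eq_true_eq]
  rfl

/-- What the simulator hands to the trusted party in the second activation. -/
def handIn (v3 : S.View3 M.Coins) (up3 : Fin S.n → Option S.Sig) :
    (ClientSet S.n × (Fin S.n → Option S.Vec)) × ClientSet S.n :=
  ((v3.2.1, fun i => if v3.2.1 i = true then
    ((M.send2 v3.1).2 i).elim none fun p => some p.1 else none), fun i => (up3 i).isSome)

/-- The same `continuation` generates the run in the simulator and in `viewDist`; only what is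
returned at the end differs. -/
theorem den_second (l : Ty.leak.Val S M) (ρ : M.Coins) (sk : Fin S.n → S.SSK × S.SPK)
    (ck : Fin S.n → S.CSK × S.CPK) (sks : S.SSK × S.SPK) (cks : S.CSK × S.CPK) :
    Sim.second.den S C M (l, (ρ, sk, ck, sks, cks), ()) =
      (viewDist1 S C M ρ sk ck sks cks (usedShare l)).bind fun v1 =>
        continuation S C M sk sks v1 fun v3 up3 =>
          PMF.pure (handIn v3 up3, (v3, up3, delivered S C M v1, (ρ, sk, ck, sks, cks))) := by
  simp only [Sim.second, Prog.den, Op.eval, Var.lookup, PMF.pure_bind]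
  erw [den_view1]
  simp only [viewDist1, PMF.bind_bind, PMF.pure_bind]
  refine congrArg _ (funext fun msg1 => ?_)
  erw [den_arrived, PMF.pure_bind, den_accepted, PMF.pure_bind]
  refine congrArg _ (funext fun σ3 => ?_)
  erw [den_confirmations]
  refine congrArg _ (funext fun up3 => ?_)
  simp only [sampleAll_pure, ite_pure, elim_pure, elim_isSome, PMF.pure_bind, Bool.not_true]
  rfl

/-- The forwarded confirmations, from the list received from the trusted party. -/
def forwardedFrom (C : Finset (Fin S.n)) (l : Option (ClientSet S.n))
    (up3 : Fin S.n → Option S.Sig) : S.Msg4 :=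
  l.elim none fun U3 =>
    if (!decide (∀ j, (!(decide (j ∈ C) && U3 j)) = true)) = true then
      some fun i => if U3 i = true then up3 i else none
    else none

/-- The view is fixed before the unmasking data are computed, so their computation integrates out.
-/
theorem map_snd_den_third (l : Option (ClientSet S.n)) (mid : Ty.middle.Val S M) :
    (Sim.third.den S C M (l, mid, ())).map Prod.snd =
      PMF.pure (mid.1, forwardedFrom C l mid.2.1) := by
  simp only [Sim.third, Sim.finalView, Prog.den, Var.lookup, Op.eval, PMF.pure_bind,
    sampleAll_pure, ite_pure, elim_pure, PMF.map_bind, PMF.pure_map, PMF.bind_const]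
  rfl

end Views

/-! ## The ideal execution -/

section IdealView

variable (S : Setting) (C : Finset (Fin S.n)) (M : Adversary S)

/-- What the trusted party sends to the corrupted clients after the first activation. -/
def leakOf (d : Option (ClientSet S.n × (Fin S.n → Fin S.n → Option (ZMod S.P)))) :
    Option (ClientSet S.n × (Fin S.n → Fin S.n → Option (ZMod S.P))) :=
  d.bind fun r =>
    if ∃ j ∈ C, r.1 j then some (r.1, fun i j => if j ∈ C ∧ r.1 j then r.2 i j else none) else none

/-- The list that the trusted party sends to the corrupted clients after the second activation. -/
def listOf (x : {i : Fin S.n // i ∉ C} → Fin S.m → ZMod S.q) (hseed : Fin S.n → ZMod S.q)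
    (d : Option (ClientSet S.n × (Fin S.n → Fin S.n → Option (ZMod S.P))))
    (b : (ClientSet S.n × (Fin S.n → Option S.Vec)) × ClientSet S.n) : Option (ClientSet S.n) :=
  (d.bind fun r => Functionality.collect S r.1 fun i =>
    if h : i ∈ C then b.1.2 i
    else if b.1.1 i then some (S.mask (x ⟨i, h⟩) (hseed i)) else none).bind fun A =>
      if ∃ j ∈ C, A j then Functionality.confirm S A b.2 else none

/-- In `ideal` the list `U₃` is itself obtained by binding `U₂`, and is then used under a second
bind of `U₂`; this removes the repetition. -/
theorem bind_ite_bind {α β : Type} (o : Option α) (p : α → Prop) [DecidablePred p]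
    (f : α → Option β) :
    (o.bind fun a => if p a then f a else none) =
      o.bind fun a => if p a then o.bind f else none := by
  cases o <;> rfl

theorem SIM_eq_den (sim : Simulator) (x : {i : Fin S.n // i ∉ C} → Fin S.m → ZMod S.q) :
    SIM S C M sim x =
      (sampleAll fun _ : Fin S.n => S.randSeed).bind fun hseed =>
      (sim.first.den S C M ()).bind fun a =>
      (Functionality.distribute S fun i =>
        if i ∈ C then a.1.2 i else if a.1.1 i then some (hseed i) else none).bind fun d =>
      (sim.second.den S C M (leakOf S C d, (a.2, ()))).bind fun b =>
      (sim.third.den S C M (listOf S C x hseed d b.1, (b.2, ()))).map Prod.snd := by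
  simp only [SIM, ideal, bind, PMF.map_bind, PMF.pure_map]
  refine congrArg _ (funext fun hseed => ?_)
  rw [← Prog.run_bind]
  refine congrArg _ (funext fun a => congrArg _ (funext fun d => ?_))
  rw [← Prog.run_bind]
  refine congrArg _ (funext fun b => ?_)
  rw [← Prog.map_fst_run, PMF.map_comp, ← PMF.bind_pure_comp,
    show listOf S C x hseed d b.1.1 = _ from bind_ite_bind _ _ _]
  rfl

/-! ### The simulated view has the input-free distribution -/

variable {S C M}

theorem den_first :
    Sim.first.den S C M () = (sampleAll fun _ : Fin S.n => S.randSeed).bind fun cs =>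
      (startDist S M).bind fun st => PMF.pure ((fun _ => true, fun i => some (cs i)), st) := by
  simp only [Sim.first, startDist, Prog.den, Op.eval, PMF.pure_bind, sampleAll_pure, PMF.bind_bind,
    ← sampleAll_bind]

theorem size_true : size (fun _ : Fin S.n => true) = S.n := by simp [size, members]

theorem distribute_some (s : Fin S.n → ZMod S.q) :
    Functionality.distribute S (fun i => some (s i)) =
      (sampleAll fun i => S.share (s i)).bind fun sh =>
        PMF.pure (some (fun _ => true, fun i j => some (sh i j))) := by
  have h := sampleAll_map (fun i => S.share (s i)) (fun _ => some)
  simp only [Functionality.distribute, ← h, PMF.bind_map, Option.isSome_some, size_true,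
    S.t_lt.le, if_true]
  rfl

/-- Only entries with a corrupted receiver are encrypted into the view, and precisely these are
leaked. -/
theorem viewDist1_usedShare (ρ : M.Coins) (sk : Fin S.n → S.SSK × S.SPK)
    (ck : Fin S.n → S.CSK × S.CPK) (sks : S.SSK × S.SPK) (cks : S.CSK × S.CPK)
    (sh : Fin S.n → Fin S.n → ZMod S.P) :
    viewDist1 S C M ρ sk ck sks cks
        (usedShare (M := M) (leakOf S C (some (fun _ => true, fun i j => some (sh i j))))) =
      viewDist1 S C M ρ sk ck sks cks sh := by
  have h (i j : Fin S.n) (hj : j ∈ C) :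
      usedShare (M := M) (leakOf S C (some (fun _ => true, fun i j => some (sh i j)))) i j =
        sh i j := by
    -- The trusted party sends its message only if some corrupted client is in `U₁`; the receiver
    -- `j` is one.
    have : ∃ j, j ∈ C := ⟨j, hj⟩
    simp [usedShare, leakOf, this, hj]
  unfold viewDist1 cipherDist
  congr! 6 with i j hij
  rw [h i j hij.2.1]

theorem accepted_isSome {pk : Fin S.n → S.SPK} {v1 : S.View1 M.Coins} {i : Fin S.n} (hi : i ∈ C)
    (h : acceptedClients S C M pk v1 i = true) : ((M.send2 v1).2 i).isSome = true := by
  simp only [acceptedClients, hi, if_true, Bool.and_eq_true] at h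
  cases h' : (M.send2 v1).2 i <;> simp_all

theorem size_mono {n : ℕ} {A B : ClientSet n} (h : ∀ i, A i = true → B i = true) :
    size A ≤ size B :=
  Finset.card_le_card fun i hi => by simp_all [members]

/-- The trusted party recovers the simulated `U₂` from the handed-in data, hence also `U₃`. The two
executions abort under different conditions, but the forwarded message agrees in every case. -/
theorem forwardedFrom_listOf (x : {i : Fin S.n // i ∉ C} → Fin S.m → ZMod S.q)
    (hseed : Fin S.n → ZMod S.q) (sh : Fin S.n → Fin S.n → Option (ZMod S.P))
    (v3 : S.View3 M.Coins) (up3 : Fin S.n → Option S.Sig)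
    (h : ∀ i ∈ C, v3.2.1 i = true → ((M.send2 v3.1).2 i).isSome = true) :
    forwardedFrom C (listOf S C x hseed (some (fun _ => true, sh)) (handIn v3 up3)) up3 =
      forwarded S C (confirmedClients S v3.2.1 up3) up3 := by
  -- The factor `true` is membership in the trusted party's `U₁`. For corrupted `i`, the hypothesis
  -- `h` guarantees that a model exists to hand in.
  have hU : (fun i => true && (if h : i ∈ C then (handIn v3 up3).1.2 i
      else if (handIn v3 up3).1.1 i then some (S.mask (x ⟨i, h⟩) (hseed i))
        else none : Option S.Vec).isSome) = v3.2.1 := by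
    funext i
    by_cases hi : i ∈ C
    · cases hv : v3.2.1 i
      · simp [handIn, hi, hv]
      · have := h i hi hv
        cases h' : (M.send2 v3.1).2 i <;> simp_all [handIn]
    · cases hv : v3.2.1 i <;> simp [handIn, hi, hv]
  -- The trusted party also aborts when `U₂` has fewer than `t` members. As `U₃ ⊆ U₂`, the server
  -- then aborts as well.
  have hle : size (confirmedClients S v3.2.1 up3) ≤ size v3.2.1 :=
    size_mono fun i hi => by
      simp only [confirmedClients, Bool.and_eq_true] at hi
      exact hi.1
  simp only [listOf, Option.bind_some, Functionality.collect, hU]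
  by_cases h3 : S.t ≤ size (confirmedClients S v3.2.1 up3)
  · have h2 := h3.trans hle
    simp only [h2, if_true, Option.bind_some, Functionality.confirm]
    change forwardedFrom C (if ∃ j ∈ C, v3.2.1 j = true then
      if S.t ≤ size (confirmedClients S v3.2.1 up3) then some (confirmedClients S v3.2.1 up3)
      else none else none) up3 = _
    simp only [h3, if_true, forwarded, true_and]
    by_cases hC : ∃ j ∈ C, confirmedClients S v3.2.1 up3 j = true
    · have hC' : ∃ j ∈ C, v3.2.1 j = true := by
        obtain ⟨j, hj, hj'⟩ := hC
        simp only [confirmedClients, Bool.and_eq_true] at hj'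
        exact ⟨j, hj, hj'.1⟩
      simp [hC, hC', forwardedFrom]
    -- Here `U₃` may still be revealed because of a corrupted client in `U₂`; the simulator's own
    -- test then suppresses the message.
    · have : ∀ j ∈ C, confirmedClients S v3.2.1 up3 j = false := by simpa using hC
      rw [if_neg hC]
      split
      · simp [forwardedFrom]
        exact this
      · rfl
  · have hf : forwarded S C (confirmedClients S v3.2.1 up3) up3 = none := if_neg fun h => h3 h.1
    rw [hf]
    split
    · simp only [Option.bind_some, Functionality.confirm]
      change forwardedFrom C (if ∃ j ∈ C, v3.2.1 j = true then
        if S.t ≤ size (confirmedClients S v3.2.1 up3) then some (confirmedClients S v3.2.1 up3)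
        else none else none) up3 = _
      simp [h3, forwardedFrom]
    · rfl

theorem SIM_eq_viewDist (x : {i : Fin S.n // i ∉ C} → Fin S.m → ZMod S.q) :
    SIM S C M simulator x = viewDist S C M := by
  have key (hseed cs : Fin S.n → ZMod S.q) (st : Ty.start.Val S M) :
      ((Functionality.distribute S fun i =>
          if i ∈ C then some (cs i) else if true = true then some (hseed i) else none).bind fun d =>
        (Sim.second.den S C M (leakOf S C d, (st, ()))).bind fun b =>
        (Sim.third.den S C M (listOf S C x hseed d b.1, (b.2, ()))).map Prod.snd) =
      (sampleAll fun i => S.share (if i ∈ C then cs i else hseed i)).bind (viewDistFrom S C M st)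
      := by
    have h : (fun i => if i ∈ C then some (cs i) else if true = true then some (hseed i) else none) =
        fun i => some (if i ∈ C then cs i else hseed i) := by
      funext i
      split <;> simp
    obtain ⟨ρ, sk, ck, sks, cks⟩ := st
    rw [h, distribute_some, PMF.bind_bind]
    refine congrArg _ (funext fun sh => ?_)
    rw [PMF.pure_bind]
    erw [den_second]
    rw [viewDist1_usedShare, PMF.bind_bind]
    refine congrArg _ (funext fun v1 => ?_)
    simp only [continuation, PMF.bind_bind, PMF.pure_bind]
    refine congrArg _ (funext fun σ3 => congrArg _ (funext fun up3 => ?_))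
    erw [map_snd_den_third, forwardedFrom_listOf]
    · rfl
    · exact fun i hi h => accepted_isSome hi h
  -- Corrupted seeds come from the simulator and honest ones from the honest clients. Coordinatewise
  -- one of two independent uniform seeds is selected and the other integrates out, leaving one
  -- uniform seed per client.
  have hshares : (sampleAll fun _ : Fin S.n => S.randSeed.bind S.share) =
      (sampleAll fun _ : Fin S.n => S.randSeed).bind fun hseed =>
      (sampleAll fun _ : Fin S.n => S.randSeed).bind fun cs =>
      sampleAll fun i => S.share (if i ∈ C then cs i else hseed i) := by
    have h1 (hseed : Fin S.n → ZMod S.q) := sampleAll_bind (fun _ : Fin S.n => S.randSeed)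
      fun i c => S.share (if i ∈ C then c else hseed i)
    have h2 := sampleAll_bind (fun _ : Fin S.n => S.randSeed)
      fun i s => S.randSeed.bind fun c => S.share (if i ∈ C then c else s)
    simp only [h1, h2]
    refine congrArg sampleAll (funext fun i => ?_)
    by_cases hi : i ∈ C <;> simp [hi]
  have hview : viewDist S C M = (sampleAll fun _ : Fin S.n => S.randSeed).bind fun hseed =>
      (sampleAll fun _ : Fin S.n => S.randSeed).bind fun cs => (startDist S M).bind fun st =>
      (sampleAll fun i => S.share (if i ∈ C then cs i else hseed i)).bind
        (viewDistFrom S C M st) := by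
    rw [viewDist, PMF.bind_comm, hshares]
    simp only [PMF.bind_bind]
    -- Seeds are drawn before the keys in the ideal execution but shares after them, hence a second
    -- exchange of draws.
    refine congrArg _ (funext fun hseed => congrArg _ (funext fun cs => ?_))
    rw [PMF.bind_comm]
  rw [SIM_eq_den, hview]
  refine congrArg _ (funext fun hseed => ?_)
  refine (congrArg (fun p => PMF.bind p _) den_first).trans ?_
  refine (PMF.bind_bind _ _ _).trans (congrArg _ (funext fun cs => ?_))
  refine (PMF.bind_bind _ _ _).trans (congrArg _ (funext fun st => ?_))
  exact (PMF.pure_bind _ _).trans (key hseed cs st)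

end IdealView

/-! ## The real execution -/

section RealView

variable {S : Setting} {C : Finset (Fin S.n)} {M : Adversary S}

/-- The protocol draws ciphertexts and signatures for all pairs, `cipherDist` only for delivered
messages to corrupted clients. Draws are independent over pairs, so the unused ones integrate out.
-/
theorem cipherDist_eq (v0 : S.View0 M.Coins) (sk : Fin S.n → S.SSK × S.SPK)
    (ck : Fin S.n → S.CSK × S.CPK) (sh : Fin S.n → Fin S.n → ZMod S.P) {β : Type}
    (k : S.Msg1 → PMF β) :
    (cipherDist S C M v0 sk ck sh).bind k =
      (sampleAll fun i => sampleAll fun j => S.encr.enc (ck j).2 (sh i j)).bind fun ct =>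
      (sampleAll fun i => sampleAll fun j => S.sign.sign (sk i).1 (.cipher (ct i j))).bind fun σ1 =>
        k fun i j => if i ∉ C ∧ j ∈ C ∧ M.deliver1 v0 i j then some (ct i j, σ1 i j) else none := by
  have h1 := sampleAll_bind_bind
    (fun i => sampleAll fun j => S.encr.enc (ck j).2 (sh i j))
    (fun i c => sampleAll fun j => S.sign.sign (sk i).1 (.cipher (c j)))
    (fun i c σ j => if i ∉ C ∧ j ∈ C ∧ M.deliver1 v0 i j then some (c j, σ j) else none) k
  rw [h1]
  refine congrArg (fun p => PMF.bind p k) (congrArg sampleAll (funext fun i => ?_))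
  have h2 := sampleAll_bind_bind (fun j => S.encr.enc (ck j).2 (sh i j))
    (fun j c => S.sign.sign (sk i).1 (.cipher c))
    (fun j c σ => if i ∉ C ∧ j ∈ C ∧ M.deliver1 v0 i j then some (c, σ) else none) PMF.pure
  simp only [PMF.bind_pure] at h2
  simp only [← PMF.bind_pure_comp, Function.comp_def] at h2 ⊢
  rw [h2]
  refine congrArg sampleAll (funext fun j => ?_)
  split
  · rfl
  · simp

/-- The messages of step 1 received in the real execution. -/
def received (v1 : S.View1 M.Coins) (ct : Fin S.n → Fin S.n → S.CT)
    (σ1 : Fin S.n → Fin S.n → S.Sig) (i j : Fin S.n) : Option (S.CT × S.Sig) :=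
  if i ∈ C then (M.send1 v1).2 i j
  else if j ∈ C then v1.2 i j
  else if i = j ∨ (M.send1 v1).1 i j then some (ct i j, σ1 i j) else none

/-- The masked models sent in the real execution. -/
def maskedDist (x : {i : Fin S.n // i ∉ C} → Fin S.m → ZMod S.q) (sk : Fin S.n → S.SSK × S.SPK)
    (seed : Fin S.n → ZMod S.q) (v1 : S.View1 M.Coins)
    (recv : Fin S.n → Fin S.n → Option (S.CT × S.Sig)) :
    PMF (Fin S.n → Option (S.Vec × S.Sig)) :=
  sampleAll fun i =>
    if h : i ∈ C then PMF.pure ((M.send2 v1).2 i)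
    else if decide (∀ j, (recv j i).all
        (fun p => S.sign.verify (sk j).2 (.cipher p.1) p.2) = true) && (M.send2 v1).1 i then
      (S.sign.sign (sk i).1 (.masked (S.mask (x ⟨i, h⟩) (seed i)))).bind fun σ =>
        PMF.pure (some (S.mask (x ⟨i, h⟩) (seed i), σ))
    else PMF.pure none

/-- The set `U₂` in the real execution. -/
def realAccepted (sk : Fin S.n → S.SSK × S.SPK)
    (recv : Fin S.n → Fin S.n → Option (S.CT × S.Sig)) (up2 : Fin S.n → Option (S.Vec × S.Sig)) :
    ClientSet S.n := fun i =>
  decide (S.t ≤ size fun j => decide (j ≠ i) && (recv i j).isSome) &&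
    (up2 i).any fun p => S.sign.verify (sk i).2 (.masked p.1) p.2

theorem received_isSome (v1 : S.View1 M.Coins) (ct : Fin S.n → Fin S.n → S.CT)
    (σ1 : Fin S.n → Fin S.n → S.Sig) (i j : Fin S.n) :
    (received (C := C) v1 ct σ1 i j).isSome = delivered S C M v1 i j := by
  simp only [received, delivered]
  split
  · rfl
  · split
    · rfl
    · by_cases h : i = j ∨ (M.send1 v1).1 i j = true
      · simp [h]
      · rw [if_neg h]
        simpa using h

/-- Whether a message of step 1 is acceptable depends on messages of corrupted clients only. -/
theorem received_all {sk : Fin S.n → S.SSK × S.SPK} (v1 : S.View1 M.Coins)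
    {ct : Fin S.n → Fin S.n → S.CT} {σ1 : Fin S.n → Fin S.n → S.Sig}
    (hσ : ∀ i j, S.sign.verify (sk i).2 (.cipher (ct i j)) (σ1 i j) = true)
    {i : Fin S.n} (hi : i ∉ C) (j : Fin S.n) :
    (received (C := C) v1 ct σ1 j i).all (fun p => S.sign.verify (sk j).2 (.cipher p.1) p.2) =
      if j ∈ C then ((M.send1 v1).2 j i).elim true fun p =>
        S.sign.verify (sk j).2 (.cipher p.1) p.2 else true := by
  simp only [received, hi, if_false]
  split
  · cases (M.send1 v1).2 j i <;> rfl
  · split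
    · exact hσ j i
    · rfl

/-- Honest masked models are always accepted. -/
theorem realAccepted_eq {x : {i : Fin S.n // i ∉ C} → Fin S.m → ZMod S.q}
    {sk : Fin S.n → S.SSK × S.SPK} (hsk : ∀ i, sk i ∈ S.sign.keygen.support)
    {seed : Fin S.n → ZMod S.q} {v1 : S.View1 M.Coins}
    {ct : Fin S.n → Fin S.n → S.CT} {σ1 : Fin S.n → Fin S.n → S.Sig}
    (hσ : ∀ i j, S.sign.verify (sk i).2 (.cipher (ct i j)) (σ1 i j) = true)
    {up2 : Fin S.n → Option (S.Vec × S.Sig)}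
    (h : up2 ∈ (maskedDist x sk seed v1 (received (C := C) v1 ct σ1)).support) :
    realAccepted sk (received (C := C) v1 ct σ1) up2 =
      acceptedClients S C M (fun i => (sk i).2) v1 := by
  funext i
  have hi := mem_support_sampleAll h i
  simp only [realAccepted, acceptedClients, received_isSome, decide_not]
  -- The `U₁` condition agrees on both sides; what remains is acceptance of the model.
  congr 1
  by_cases hC : i ∈ C
  · simp only [hC, dif_pos, PMF.mem_support_pure_iff] at hi
    rw [hi, if_pos hC]
    cases (M.send2 v1).2 i <;> rfl
  · simp only [hC, dif_neg, not_false_eq_true, received_all v1 hσ hC] at hi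
    rw [if_neg hC]
    split at hi
    · next hc =>
      rw [hc]
      simp only [PMF.mem_support_bind_iff, PMF.mem_support_pure_iff] at hi
      obtain ⟨σ, hs, hi⟩ := hi
      rw [hi]
      -- Acceptance holds whatever the masked vector is; this is where the input disappears from
      -- `U₂`.
      exact S.sign.correct _ (hsk i) _ _ hs
    · next hc =>
      rw [PMF.mem_support_pure_iff] at hi
      rw [hi]
      exact (Bool.eq_false_iff.2 hc).symm

/-- The end of the execution, for a given set `U₂`. -/
def viewDist3 (C : Finset (Fin S.n)) (sk : Fin S.n → S.SSK × S.SPK) (sks : S.SSK × S.SPK)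
    (v1 : S.View1 M.Coins) (U2 : ClientSet S.n) : PMF (S.View M.Coins) :=
  (S.sign.sign sks.1 (.clients U2)).bind fun σ3 =>
    (confirmDist S C M sk sks.2 (v1, (U2, σ3))).bind fun up3 =>
      PMF.pure (endView S C M (v1, (U2, σ3)) up3)

/-- Everything after the forwarded signatures is discarded with the server's output, and the masked
models then matter only through `U₂`. -/
theorem REAL_eq_viewDist (x : {i : Fin S.n // i ∉ C} → Fin S.m → ZMod S.q) :
    REAL S C M x = viewDist S C M := by
  simp only [REAL, real, bind, PMF.map_bind, PMF.pure_map, PMF.bind_const, viewDist, startDist,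
    viewDistFrom, viewDist1, PMF.bind_bind, PMF.pure_bind, cipherDist_eq, ← sampleAll_bind]
  refine congrArg _ (funext fun ρ => bind_congr_support fun sk hsk => congrArg _ (funext fun ck =>
    congrArg _ (funext fun sks => congrArg _ (funext fun cks => congrArg _ (funext fun seed =>
    congrArg _ (funext fun sh => congrArg _ (funext fun ct =>
    bind_congr_support fun σ1 hσ1 => ?_)))))))
  have hsk' (i) := mem_support_sampleAll hsk i
  have hσ (i j) : S.sign.verify (sk i).2 (.cipher (ct i j)) (σ1 i j) = true :=
    S.sign.correct _ (hsk' i) _ _ (mem_support_sampleAll (mem_support_sampleAll hσ1 i) j)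
  set v0 := initialView S C M ρ sk ck sks cks with hv0
  set v1 : S.View1 M.Coins := (v0, fun i j =>
    if i ∉ C ∧ j ∈ C ∧ M.deliver1 v0 i j = true then some (ct i j, σ1 i j) else none) with hv1
  change _ = viewDist3 C sk sks v1 (acceptedClients S C M (fun i => (sk i).2) v1)
  -- The middle term isolates the masked models: they occur only in the argument `realAccepted` of
  -- `viewDist3`. Once that argument is constant on the support, `PMF.bind_const` removes them.
  refine Eq.trans (b := (maskedDist x sk seed v1 (received (C := C) v1 ct σ1)).bind fun up2 =>
    viewDist3 C sk sks v1 (realAccepted sk (received (C := C) v1 ct σ1) up2)) ?_ ?_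
  · refine congrArg _ (funext fun up2 => congrArg _ (funext fun σ3 => ?_))
    simp only [confirmDist, endView, forwarded, ← Bool.and_assoc, decide_eq_true_eq]
    rfl
  · refine (bind_congr_support fun up2 h => ?_).trans (PMF.bind_const _ _)
    rw [realAccepted_eq hsk' hσ h]

end RealView

end HSecAgg

end

theorem theorem3 :
    ∃ (sim : HSecAgg.Simulator) (p : Polynomial ℕ),
      ∀ (S : HSecAgg.Setting) (C : Finset (Fin S.n)) (M : HSecAgg.Adversary S), C.card < S.t →
        ∀ x : {i : Fin S.n // i ∉ C} → Fin S.m → ZMod S.q,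
          HSecAgg.SIM S C M sim x = HSecAgg.REAL S C M x ∧
          ∀ o ∈ (HSecAgg.ideal S C M sim x).support,
            o.steps ≤ p.eval (S.κ + S.n + S.m + S.callTime + M.time) := by
  obtain ⟨p, hp⟩ := HSecAgg.simulator.exists_steps_le
  exact ⟨HSecAgg.simulator, p, fun S C M _ x =>
    ⟨(HSecAgg.SIM_eq_viewDist x).trans (HSecAgg.REAL_eq_viewDist x).symm, hp S C M x⟩⟩
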